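/- A *canonical hypergroup* is a set $H$ with an element $0$ and an operation $+$ assigning to $x,y\in H$ a non-empty subset $x+y\subseteq H$, such that $+$ is commutative and associative (with $A+B=\bigcup_{a\in A,\,b\in B}(a+b)$), $0+x=\{x\}$, for each $x$ there is a unique element $-x$ with $0\in x+(-x)$, and $x\in y+z$ implies $z\in x+(-y)$. A *hyperring* is a canonical hypergroup with an associative multiplication with unit $1\neq 0$, for which $0$ is absorbing and which is distributive over $+$ on both sides; it is a *hyperfield* if its non-zero elements form a group under multiplication, and it is *commutative* if its multiplication is. An *isomorphism* of hyperrings is a multiplicative bijection $f$ with $f(a+b)=f(a)+f(b)$ for all $a,b$. The *Krasner hyperfield* $\mathbf K=\{0,1\}$ has its usual multiplication, neutral element $0$, and $1+1=\{0,1\}$. A hyperfield *extension* of $\mathbf K$ is a hyperfield containing $\mathbf K$ as a sub-hyperfield, so that $1+1=\{0,1\}$ in it. The *geometry associated* to a hyperfield extension $\mathbb H$ of $\mathbf K$ has the points $\mathbb H\setminus\{0\}$ and the lines $L(x,y)=(x+y)\cup\{x,y\}$ for points $x\neq y$. A set of points is a *subspace* if it contains $L(x,y)$ for any two of its points $x\ne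 y$; the *dimension* of the geometry is the smallest cardinality of a set of points not contained in a proper subspace, minus one ($\infty$ if no such set is finite). The geometry is *Desarguesian* if, for all points $o,a_1,a_2,a_3,b_1,b_2,b_3$ with $a_i\neq b_i$ and $o,a_i,b_i$ collinear for each $i$, with no three of $o,a_1,a_2,a_3$ collinear and no three of $o,b_1,b_2,b_3$ collinear, any points $c_{ij}\in L(a_i,a_j)\cap L(b_i,b_j)$ ($1\le i<j\le 3$) are collinear. For a field $F$ and a subfield $K\subseteq F$, let $F/K^\times$ be the hyperring of orbits $xK^\times$ ($x\in F$), with multiplication $xK^\times\cdot yK^\times=xyK^\times$ and hyperaddition $xK^\times+yK^\times=\{zK^\times : z\in xK^\times+yK^\times\subseteq F\}$. **Theorem 3.6.** Let $\mathbb H$ be a commutative hyperfield extension of $\mathbf K$ whose associated geometry is Desarguesian and of dimension $\geq 2$. Then there exist a commutative field $F$, a subfield $K\subseteq F$ and an isomorphism of hyperrings $\varphi\colon F/K^\times\to\mathbb H$. They are unique up to unique isomorphism: for every commutative field $F'$, subfield $K'\subseteq F'$ and isomorphism of hyperrings $\varphi'\colon F'/K'^\times\to\mathbb H$, there is exactly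 one field isomorphism $\sigma\colon F\to F'$ such that $\sigma(K)=K'$ and $\varphi'(\sigma(x)K'^\times)=\varphi(xK^\times)$ for all $x\in F$. -/

import Mathlib

universe u v

/-- A hyperring: a canonical hypergroup with a multiplication making it a monoid with absorbing
element `0 ≠ 1` over which the hyperaddition is distributive. `hadd x y` is the set `x + y`. -/
class Hyperring (R : Type*) extends MonoidWithZero R where
  hadd : R → R → Set R
  hadd_nonempty : ∀ x y, (hadd x y).Nonempty
  hadd_comm : ∀ x y, hadd x y = hadd y x
  hadd_assoc : ∀ x y z, (⋃ w ∈ hadd x y, hadd w z) = ⋃ w ∈ hadd y z, hadd x w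
  zero_hadd : ∀ x, hadd 0 x = {x}
  existsUnique_neg : ∀ x, ∃! y, (0 : R) ∈ hadd x y
  /-- Reversibility: if `x ∈ y + z` then `z ∈ x - y`, where `y'` is the opposite `-y` of `y`. -/
  reversible : ∀ x y z y', x ∈ hadd y z → (0 : R) ∈ hadd y y' → z ∈ hadd x y'
  mul_hadd : ∀ r s t, (fun u => r * u) '' hadd s t = hadd (r * s) (r * t)
  hadd_mul : ∀ r s t, (fun u => u * r) '' hadd s t = hadd (s * r) (t * r)
  zero_ne_one : (0 : R) ≠ 1

open Hyperring (hadd)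

/-- A hyperring is a hyperfield if its nonzero elements form a group under multiplication. -/
def Hyperring.IsHyperfield (R : Type*) [Hyperring R] : Prop :=
  ∀ x : R, x ≠ 0 → ∃ y : R, x * y = 1 ∧ y * x = 1

/-- An isomorphism of hyperrings: a multiplicative bijection with `f (a + b) = f a + f b`
as sets. -/
structure HyperringIso (R S : Type*) [Hyperring R] [Hyperring S] extends R ≃* S where
  map_hadd : ∀ a b : R, toFun '' hadd a b = hadd (toFun a) (toFun b)

/-- The underlying set `{0, 1}` of the Krasner hyperfield. -/
inductive Krasner : Type
  | zero
  | one

namespace Krasner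

/-- Usual multiplication on `{0, 1}`. -/
def mul : Krasner → Krasner → Krasner
  | one, one => one
  | _, _ => zero

/-- Hyperaddition: `0` is neutral and `1 + 1 = {0, 1}`. -/
def add : Krasner → Krasner → Set Krasner
  | zero, x => {x}
  | x, zero => {x}
  | one, one => {zero, one}

/-- The Krasner hyperfield. -/
instance : Hyperring Krasner where
  zero := zero
  one := one
  mul := mul
  mul_assoc a b c := by cases a <;> cases b <;> cases c <;> rfl
  one_mul a := by cases a <;> rfl
  mul_one a := by cases a <;> rfl
  zero_mul a := by cases a <;> rfl
  mul_zero a := by cases a <;> rfl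
  hadd := add
  hadd_nonempty a b := by cases a <;> cases b <;> simp [add]
  hadd_comm a b := by cases a <;> cases b <;> simp [add]
  hadd_assoc a b c := by
    cases a <;> cases b <;> cases c <;> ext w <;> cases w <;> simp [add]
  zero_hadd a := by cases a <;> rfl
  existsUnique_neg a := by
    change ∃! y, zero ∈ add a y
    refine ⟨a, by cases a <;> simp [add], fun y => ?_⟩
    cases a <;> cases y <;> simp [add]
  reversible a b c d := by
    change a ∈ add b c → zero ∈ add b d → c ∈ add a d
    cases a <;> cases b <;> cases c <;> cases d <;> simp [add]
  mul_hadd a b c := by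
    change (fun u => mul a u) '' add b c = add (mul a b) (mul a c)
    cases a <;> cases b <;> cases c <;> simp [add, mul, Set.image_pair]
  hadd_mul a b c := by
    change (fun u => mul u a) '' add b c = add (mul b a) (mul c a)
    cases a <;> cases b <;> cases c <;> simp [add, mul, Set.image_pair]
  zero_ne_one := by
    change zero ≠ one
    simp

end Krasner

/-- `R` contains the Krasner hyperfield as a sub-hyperring: there is an injective unital
multiplicative map of the Krasner hyperfield into `R` that carries the sum of two elements onto the
sum, formed in `R`, of their images. -/
def Hyperring.IsKrasnerExtension (R : Type*) [Hyperring R] : Prop :=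
  ∃ i : Krasner →*₀ R, Function.Injective i ∧
    ∀ a b : Krasner, i '' hadd a b = hadd (i a) (i b)

/-- A point-line geometry: a family of subsets, called lines, of a set `P` of points. -/
structure LineGeometry (P : Type*) where
  lines : Set (Set P)

namespace LineGeometry

variable {P : Type*} (𝒢 : LineGeometry P)

/-- Three points are collinear if some line contains them. -/
def Coll (a b c : P) : Prop := ∃ L ∈ 𝒢.lines, a ∈ L ∧ b ∈ L ∧ c ∈ L

/-- A subspace contains every line that joins two distinct points of it. -/
def IsSubspace (W : Set P) : Prop :=
  ∀ x ∈ W, ∀ y ∈ W, x ≠ y → ∀ L ∈ 𝒢.lines, x ∈ L → y ∈ L → L ⊆ W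

/-- The subspace generated by a set of points. -/
def span (S : Set P) : Set P := ⋂₀ {W | 𝒢.IsSubspace W ∧ S ⊆ W}

/-- The projective dimension: the smallest number of points generating the geometry, minus one. -/
noncomputable def dim : ℕ∞ := (⨅ S ∈ {S : Set P | 𝒢.span S = Set.univ}, S.encard) - 1

/-- Desargues' property. If the triangles `a₁ a₂ a₃` and `b₁ b₂ b₃` are in perspective from `o`
(no three of `o, a₁, a₂, a₃` and no three of `o, b₁, b₂, b₃` being collinear, and `aᵢ ≠ bᵢ`), then
the points of intersection of corresponding sides are collinear. -/
def IsDesarguesian : Prop :=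
  ∀ o a₁ a₂ a₃ b₁ b₂ b₃ c₁₂ c₂₃ c₁₃ : P,
    ¬ 𝒢.Coll o a₁ a₂ → ¬ 𝒢.Coll o a₂ a₃ → ¬ 𝒢.Coll o a₁ a₃ → ¬ 𝒢.Coll a₁ a₂ a₃ →
    ¬ 𝒢.Coll o b₁ b₂ → ¬ 𝒢.Coll o b₂ b₃ → ¬ 𝒢.Coll o b₁ b₃ → ¬ 𝒢.Coll b₁ b₂ b₃ →
    a₁ ≠ b₁ → a₂ ≠ b₂ → a₃ ≠ b₃ →
    𝒢.Coll o a₁ b₁ → 𝒢.Coll o a₂ b₂ → 𝒢.Coll o a₃ b₃ →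
    𝒢.Coll a₁ a₂ c₁₂ → 𝒢.Coll b₁ b₂ c₁₂ →
    𝒢.Coll a₂ a₃ c₂₃ → 𝒢.Coll b₂ b₃ c₂₃ →
    𝒢.Coll a₁ a₃ c₁₃ → 𝒢.Coll b₁ b₃ c₁₃ →
    𝒢.Coll c₁₂ c₂₃ c₁₃

end LineGeometry

/-- The geometry associated to a hyperring: points are the nonzero elements, and lines are the sets
`L(x, y) = (x + y) ∪ {x, y}` for distinct points `x`, `y`. -/
def Hyperring.geometry (R : Type*) [Hyperring R] : LineGeometry {x : R // x ≠ 0} where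
  lines := {L | ∃ x y : {x : R // x ≠ 0}, x ≠ y ∧
    L = {z : {x : R // x ≠ 0} | (z : R) ∈ hadd (x : R) (y : R)} ∪
      ({x, y} : Set {x : R // x ≠ 0})}

/-- The set `R / G` of orbits of a subgroup `G` of `Rˣ` acting on `R` by multiplication. -/
def QuotientHyperring (R : Type*) [CommRing R] (G : Subgroup Rˣ) : Type _ :=
  MulAction.orbitRel.Quotient G R

namespace QuotientHyperring

variable {R : Type*} [CommRing R] (G : Subgroup Rˣ)

/-- The class `x G` of `x`. -/
def mk (x : R) : QuotientHyperring R G := Quotient.mk (MulAction.orbitRel G R) x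

variable {G}

theorem mk_eq_mk {x y : R} : mk G x = mk G y ↔ ∃ g ∈ G, (g : R) * y = x := by
  refine (Quotient.eq (r := MulAction.orbitRel G R)).trans ?_
  rw [MulAction.orbitRel_apply, MulAction.mem_orbit_iff]
  exact ⟨fun ⟨g, h⟩ => ⟨g, g.2, h⟩, fun ⟨g, hg, h⟩ => ⟨⟨g, hg⟩, h⟩⟩

theorem mk_surjective (a : QuotientHyperring R G) : ∃ x, mk G x = a := Quotient.exists_rep a

/-- The multiplication `xG · yG = xyG`. -/
def mul : QuotientHyperring R G → QuotientHyperring R G → QuotientHyperring R G :=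
  Quotient.map₂ (· * ·) (by
    rintro a b ⟨g, rfl⟩ c d ⟨h, rfl⟩
    refine ⟨g * h, ?_⟩
    change (((g * h : G) : Rˣ) : R) * (b * d) = ((g : Rˣ) : R) * b * (((h : Rˣ) : R) * d)
    push_cast
    ring)

/-- The hyperaddition `(xG + yG) / G`. -/
def add (a b : QuotientHyperring R G) : Set (QuotientHyperring R G) :=
  {c | ∃ x y : R, mk G x = a ∧ mk G y = b ∧ mk G (x + y) = c}

theorem mul_mk (x y : R) : mul (mk G x) (mk G y) = mk G (x * y) := rfl

theorem mem_add_mk {x y : R} {c : QuotientHyperring R G} :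
    c ∈ add (mk G x) (mk G y) ↔ ∃ g ∈ G, c = mk G (x + (g : R) * y) := by
  constructor
  · rintro ⟨u, v, hu, hv, rfl⟩
    obtain ⟨g, hg, rfl⟩ := mk_eq_mk.1 hu
    obtain ⟨h, hh, rfl⟩ := mk_eq_mk.1 hv
    refine ⟨g⁻¹ * h, G.mul_mem (G.inv_mem hg) hh, mk_eq_mk.2 ⟨g, hg, ?_⟩⟩
    push_cast
    rw [mul_add, ← mul_assoc, ← mul_assoc, Units.mul_inv, one_mul]
  · rintro ⟨g, hg, rfl⟩
    exact ⟨x, g * y, rfl, mk_eq_mk.2 ⟨g, hg, rfl⟩, rfl⟩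

theorem add_comm' (a b : QuotientHyperring R G) : add a b = add b a := by
  ext c
  constructor <;> rintro ⟨x, y, hx, hy, h⟩ <;> exact ⟨y, x, hy, hx, by rw [add_comm, h]⟩

theorem mk_eq_zero {x : R} : mk G x = mk G 0 ↔ x = 0 := by
  rw [mk_eq_mk]
  constructor
  · rintro ⟨g, _, h⟩
    simpa using h.symm
  · rintro rfl
    exact ⟨1, G.one_mem, by simp⟩

theorem mul_comm' (a b : QuotientHyperring R G) : mul a b = mul b a := by
  obtain ⟨a, rfl⟩ := mk_surjective a
  obtain ⟨b, rfl⟩ := mk_surjective b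
  simp only [mul_mk, mul_comm]

theorem mul_add' (a b c : QuotientHyperring R G) :
    (fun u => mul a u) '' add b c = add (mul a b) (mul a c) := by
  obtain ⟨a, rfl⟩ := mk_surjective a
  obtain ⟨b, rfl⟩ := mk_surjective b
  obtain ⟨c, rfl⟩ := mk_surjective c
  ext w
  simp only [mul_mk, Set.mem_image, mem_add_mk]
  constructor
  · rintro ⟨_, ⟨g, hg, rfl⟩, rfl⟩
    exact ⟨g, hg, by rw [mul_mk]; congr 1; ring⟩
  · rintro ⟨g, hg, rfl⟩
    exact ⟨_, ⟨g, hg, rfl⟩, by rw [mul_mk]; congr 1; ring⟩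

/-- The quotient hyperring `R / G`. -/
instance [Nontrivial R] : Hyperring (QuotientHyperring R G) where
  zero := mk G 0
  one := mk G 1
  mul := mul
  mul_assoc a b c := by
    obtain ⟨a, rfl⟩ := mk_surjective a
    obtain ⟨b, rfl⟩ := mk_surjective b
    obtain ⟨c, rfl⟩ := mk_surjective c
    exact congrArg (mk G) (mul_assoc a b c)
  one_mul a := by
    obtain ⟨a, rfl⟩ := mk_surjective a
    exact congrArg (mk G) (one_mul a)
  mul_one a := by
    obtain ⟨a, rfl⟩ := mk_surjective a
    exact congrArg (mk G) (mul_one a)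
  zero_mul a := by
    obtain ⟨a, rfl⟩ := mk_surjective a
    exact congrArg (mk G) (zero_mul a)
  mul_zero a := by
    obtain ⟨a, rfl⟩ := mk_surjective a
    exact congrArg (mk G) (mul_zero a)
  hadd := add
  hadd_nonempty a b := by
    obtain ⟨a, rfl⟩ := mk_surjective a
    obtain ⟨b, rfl⟩ := mk_surjective b
    exact ⟨mk G (a + b), a, b, rfl, rfl, rfl⟩
  hadd_comm := add_comm'
  hadd_assoc a b c := by
    ext w
    simp only [Set.mem_iUnion, exists_prop]
    constructor
    · rintro ⟨_, ⟨x, y, rfl, rfl, rfl⟩, u, z, hu, rfl, rfl⟩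
      obtain ⟨g, hg, rfl⟩ := mk_eq_mk.1 hu
      exact ⟨mk G (g * y + z), ⟨g * y, z, mk_eq_mk.2 ⟨g, hg, rfl⟩, rfl, rfl⟩,
        g * x, g * y + z, mk_eq_mk.2 ⟨g, hg, rfl⟩, rfl, by congr 1; ring⟩
    · rintro ⟨_, ⟨y, z, rfl, rfl, rfl⟩, x, u, rfl, hu, rfl⟩
      obtain ⟨g, hg, rfl⟩ := mk_eq_mk.1 hu
      exact ⟨mk G (x + g * y), ⟨x, g * y, rfl, mk_eq_mk.2 ⟨g, hg, rfl⟩, rfl⟩,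
        x + g * y, g * z, rfl, mk_eq_mk.2 ⟨g, hg, rfl⟩, by congr 1; ring⟩
  zero_hadd a := by
    obtain ⟨a, rfl⟩ := mk_surjective a
    ext w
    change w ∈ add (mk G 0) (mk G a) ↔ w = mk G a
    rw [mem_add_mk]
    constructor
    · rintro ⟨g, hg, rfl⟩
      exact mk_eq_mk.2 ⟨g, hg, by simp⟩
    · rintro rfl
      exact ⟨1, G.one_mem, by simp⟩
  existsUnique_neg a := by
    obtain ⟨a, rfl⟩ := mk_surjective a
    refine ⟨mk G (-a), ⟨a, -a, rfl, rfl, by rw [add_neg_cancel]; rfl⟩, fun b hb => ?_⟩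
    obtain ⟨b, rfl⟩ := mk_surjective b
    obtain ⟨g, hg, h⟩ := mem_add_mk.1 hb
    have h2 := mk_eq_zero.1 h.symm
    refine (mk_eq_mk.2 ⟨g, hg, ?_⟩).symm
    linear_combination h2
  reversible a b c d h h' := by
    obtain ⟨x, y, rfl, rfl, rfl⟩ := h
    obtain ⟨d, rfl⟩ := mk_surjective d
    obtain ⟨g, hg, h⟩ := mem_add_mk.1 h'
    have h2 := mk_eq_zero.1 h.symm
    refine mem_add_mk.2 ⟨g, hg, ?_⟩
    congr 1
    linear_combination -h2
  mul_hadd := mul_add'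
  hadd_mul r s t := by
    change (fun u => mul u r) '' add s t = add (mul s r) (mul t r)
    simp only [mul_comm' _ r]
    exact mul_add' r s t
  zero_ne_one h := zero_ne_one (mk_eq_zero.1 (Eq.symm h)).symm

end QuotientHyperring

/-- The subgroup `Kˣ` of `Fˣ` for a subfield `K` of `F`. -/
def Subfield.unitsSubgroup {F : Type*} [Field F] (K : Subfield F) : Subgroup Fˣ :=
  (Units.map (K.subtype : K →* F)).range

/-!
Write `Col a b c` for `c ∈ a + b`. As `-x = x` in `H`, this relation is symmetric, and the axioms of
the hyperaddition make it the collinearity relation of a projective geometry, Veblen's axiom being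
the law `Col.transpose`. The multiplications by nonzero elements of `H` are collineations.

*Coordinates.* A hyperplane `M` off the point `1` exists by Zorn's lemma (`Hyperplane.nonempty`).
On its affine complement every pair of points has a direction in `M`. Desargues' theorem yields the
translations (`Translation.exists_apply_eq`) and the homotheties with centre `1` (the
`HomogeneousChart` instance for `Translation.direction`). Translations form an abelian group `T`,
the endomorphisms of `T` preserving directions form a division ring `K`, and `T × K` carries
homogeneous coordinates `Hyperplane.point : T × K → H`. What is needed of them is in the class
`Coordinates`, which does not mention scalars.

*Fundamental theorem.* Two coordinatizations `π : V → H` and `π' : V' → H` are related by an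
additive map, unique once its value at one nonzero vector is given
(`Coordinates.exists_addMonoidHom`, `Chart.addMonoidHom_ext`). Applied to `π` and `g π` with `g` in
`H`, this lifts the multiplications of `H` to additive maps of `V`, and so defines a product on `V`
with a unit `e` over `1` that is associative, left distributive and has inverses
(`Coordinates.mulHom`). Applied to two fields with quotient `H`, it gives the uniqueness statement
(`Coordinates.existsUnique_ringEquiv`).

*Commutativity.* Since `H` is commutative, `v w` and `w v` differ by a scalar factor. It is enough
to show `(1 + w) u = u + w u`: then right multiplications are additive and, by the uniqueness
above, equal to left multiplications. The identity follows by comparing coefficients if `1`, `w`,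
`u`, `w u` are linearly independent (`Coordinates.deviation_eq_zero_of_indep`), which is the case
for enough `u` if `1` and `w` span a line closed under multiplication. Otherwise `1`, `w`, `w²` are
independent, and the products of `1 + w` and `1 + k w` in the two orders, for scalars `k`, show that
`w` and `1 + w` commute with each other and with the scalars (`eq_zero_of_add_eq_mul`). If the
identity failed at `u`, the difference of its two sides would then be an eigenvector of the
multiplication by `w`, which has none (`Coordinates.deviation_eq_zero_of_not_onLine`).
-/

/-! ### Collinearity as a symmetric relation -/

/-- A hyperring in which every element is idempotent up to zero: `x + x = {0, x}`. -/
class Hyperring.IsIdempotent (H : Type*) [Hyperring H] : Prop where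
  hadd_self : ∀ x : H, hadd x x = {0, x}

/-- The symmetric ternary relation `c ∈ a + b`, equivalently `0 ∈ a + b + c`. -/
def Col {H : Type*} [Hyperring H] (a b c : H) : Prop := c ∈ hadd a b

section Col

variable {H : Type*} [Hyperring H] {a b c d x y : H}

theorem Col.swap (h : Col a b c) : Col b a c := by
  unfold Col at *
  rwa [Hyperring.hadd_comm]

theorem col_zero_left : Col 0 a b ↔ b = a := by
  simp [Col, Hyperring.zero_hadd]

theorem col_zero_mid : Col a 0 b ↔ a = b :=
  ⟨fun h => (col_zero_left.1 h.swap).symm, fun h => (col_zero_left.2 h.symm).swap⟩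

theorem exists_col (a b : H) : ∃ c, Col a b c := Hyperring.hadd_nonempty a b

theorem col_mul_left (g : H) (h : Col a b c) : Col (g * a) (g * b) (g * c) := by
  unfold Col at *
  rw [← Hyperring.mul_hadd]
  exact ⟨c, h, rfl⟩

variable [Hyperring.IsIdempotent H]

theorem col_self_iff : Col a a b ↔ b = 0 ∨ b = a := by
  simp [Col, Hyperring.IsIdempotent.hadd_self]

theorem Col.rot (h : Col a b c) : Col c a b :=
  Hyperring.reversible c a b a h (col_self_iff.2 (Or.inl rfl))

theorem Col.rot' (h : Col a b c) : Col b c a := h.rot.rot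

theorem Col.swap_right (h : Col a b c) : Col a c b := h.rot.swap

theorem Col.swap_outer (h : Col a b c) : Col c b a := h.rot.swap_right

theorem col_zero_right : Col a b 0 ↔ a = b :=
  ⟨fun h => (col_zero_left.1 h.rot).symm, fun h => h ▸ col_self_iff.2 (Or.inl rfl)⟩

/-- The transposition law, which is associativity of the hyperaddition. For points it says that
if the lines `ab` and `cd` meet, then so do the lines `ac` and `bd`. -/
theorem Col.transpose (h₁ : Col a b x) (h₂ : Col c d x) : ∃ y, Col a c y ∧ Col b d y := by
  have h : d ∈ ⋃ w ∈ hadd b a, hadd w c :=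
    Set.mem_biUnion h₁.swap h₂.rot
  rw [Hyperring.hadd_assoc] at h
  simp only [Set.mem_iUnion, exists_prop] at h
  obtain ⟨y, hy, h⟩ := h
  exact ⟨y, hy, Col.swap_right h⟩

/-- Two points of a sum determine the line: `a` lies on the line through any two of them. -/
theorem Col.line (h₁ : Col a b x) (h₂ : Col a b y) : x = y ∨ Col x y a := by
  obtain ⟨z, hz, h⟩ := Col.transpose h₁.swap_right h₂.swap_right
  rcases col_self_iff.1 hz with rfl | rfl
  · exact Or.inl (col_zero_right.1 h)
  · exact Or.inr h

theorem Col.ne_left (h : Col a b c) (hb : b ≠ 0) (hab : a ≠ b) : c ≠ a := by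
  rintro rfl
  rcases col_self_iff.1 h.swap_right with h | h
  · exact hb h
  · exact hab h.symm

theorem Col.ne_zero (h : Col a b c) (hab : a ≠ b) : c ≠ 0 := by
  rintro rfl
  exact hab (col_zero_right.1 h)

/-- The sum of two distinct points has at least two elements: if `a + b = {c}` then
`a + c = a + (a + b) = (a + a) + b ∋ c`, which is impossible. -/
theorem exists_two_col (ha : a ≠ 0) (hb : b ≠ 0) (hab : a ≠ b) :
    ∃ c d, Col a b c ∧ Col a b d ∧ c ≠ d := by
  obtain ⟨c, hc⟩ := exists_col a b
  obtain ⟨d, hd, hd'⟩ := Col.transpose (col_self_iff.2 (Or.inr rfl)) hc.rot'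
  refine ⟨c, d, hc, hd, ?_⟩
  rintro rfl
  rcases col_self_iff.1 hd'.rot' with h | h
  · exact ha h
  · exact hc.ne_left hb hab h.symm

end Col

/-! ### Geometric hypotheses, gluing, and hyperplanes -/

/-- Three points that are distinct and not on a common line. -/
def Indep {H : Type*} [Hyperring H] (a b c : H) : Prop :=
  a ≠ 0 ∧ b ≠ 0 ∧ c ≠ 0 ∧ a ≠ b ∧ a ≠ c ∧ b ≠ c ∧ ¬ Col a b c

/-- The hyperaddition defines a Desarguesian projective geometry of dimension at least two. -/
class Hyperring.IsDesarguesianSpace (H : Type*) [Hyperring H] : Prop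
    extends Hyperring.IsIdempotent H where
  exists_indep : ∀ a b : H, ∃ c, c ≠ 0 ∧ c ≠ a ∧ c ≠ b ∧ ¬ Col a b c
  desargues : ∀ o a₁ a₂ a₃ b₁ b₂ b₃ c₁₂ c₂₃ c₁₃ : H,
    Indep o a₁ a₂ → Indep o a₂ a₃ → Indep o a₁ a₃ → Indep a₁ a₂ a₃ →
    Indep o b₁ b₂ → Indep o b₂ b₃ → Indep o b₁ b₃ → Indep b₁ b₂ b₃ →
    a₁ ≠ b₁ → a₂ ≠ b₂ → a₃ ≠ b₃ → Col o a₁ b₁ → Col o a₂ b₂ → Col o a₃ b₃ →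
    Col a₁ a₂ c₁₂ → Col b₁ b₂ c₁₂ → Col a₂ a₃ c₂₃ → Col b₂ b₃ c₂₃ →
    Col a₁ a₃ c₁₃ → Col b₁ b₃ c₁₃ →
    c₁₂ = c₂₃ ∨ c₁₂ = c₁₃ ∨ c₂₃ = c₁₃ ∨ Col c₁₂ c₂₃ c₁₃

/-- A partial map given by a relation `Q a a' x x'` (if `a` goes to `a'` then `x` goes to `x'`),
which makes sense only for `x` outside the class of `a` under `E`, extends to a global map as soon
as there are three classes. In the applications `E` is being on a line through a centre. -/
theorem exists_glued_map {X X' : Type*} (E : X → X → Prop) (hE : Equivalence E)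
    (m : X → X' → Prop) (Q : X → X' → X → X' → Prop)
    (hm : ∀ {a a' x x'}, Q a a' x x' → m x x')
    (hsymm : ∀ {a a' x x'}, Q a a' x x' → Q x x' a a')
    (hex : ∀ {a a' x}, m a a' → ¬ E a x → ∃ x', Q a a' x x')
    (huniq : ∀ {a a' x x' x''}, Q a a' x x' → Q a a' x x'' → x' = x'')
    (htrans : ∀ {a a' x x' y y'}, Q a a' x x' → Q a a' y y' → ¬ E x y → Q x x' y y')
    (hthree : ∀ a b, ∃ c, ¬ E a c ∧ ¬ E b c) {a : X} {a' : X'} (ha : m a a') :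
    ∃ φ : X → X', φ a = a' ∧ (∀ x, m x (φ x)) ∧ ∀ x y, ¬ E x y → Q x (φ x) y (φ y) := by
  classical
  obtain ⟨b, hab, -⟩ := hthree a a
  obtain ⟨b', hb⟩ := hex ha hab
  have key : ∀ x, ∃ x', (¬ E a x → Q a a' x x') ∧ (E a x → Q b b' x x') := by
    intro x
    by_cases hx : E a x
    · have hbx : ¬ E b x := fun h => hab (hE.trans hx (hE.symm h))
      obtain ⟨x', hx'⟩ := hex (hm hb) hbx
      exact ⟨x', fun h => absurd hx h, fun _ => hx'⟩
    · obtain ⟨x', hx'⟩ := hex ha hx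
      exact ⟨x', fun _ => hx', fun h => absurd h hx⟩
  choose φ hφ₁ hφ₂ using key
  -- the pairs with one member in the class of `a`
  have mixed : ∀ x y, E a x → ¬ E a y → Q x (φ x) y (φ y) := by
    intro x y hx hy
    have hxy : ¬ E x y := fun h => hy (hE.trans hx h)
    by_cases hby : E b y
    · obtain ⟨g, hag, hbg⟩ := hthree a b
      have hgy : ¬ E g y := fun h => hbg (hE.trans hby (hE.symm h))
      have hgx : ¬ E g x := fun h => hag (hE.trans hx (hE.symm h))
      have h₁ := htrans (hφ₁ g hag) (hφ₁ y hy) hgy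
      have h₂ := htrans hb (hφ₁ g hag) hbg
      exact htrans (htrans h₂ (hφ₂ x hx) hgx) h₁ hxy
    · exact htrans (hφ₂ x hx) (htrans hb (hφ₁ y hy) hby) hxy
  refine ⟨φ, huniq (hφ₂ a (hE.refl a)) (hsymm hb), fun x => ?_, fun x y hxy => ?_⟩
  · by_cases hx : E a x
    · exact hm (hφ₂ x hx)
    · exact hm (hφ₁ x hx)
  · by_cases hx : E a x
    · exact mixed x y hx fun hy => hxy (hE.trans (hE.symm hx) hy)
    · by_cases hy : E a y
      · exact hsymm (mixed y x hy hx)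
      · exact htrans (hφ₁ x hx) (hφ₁ y hy) hxy

/-- A hyperplane not containing `1`: a subspace, with `0` adjoined, that meets every line. -/
structure Hyperplane (H : Type*) [Hyperring H] where
  carrier : Set H
  zero_mem : 0 ∈ carrier
  add_mem : ∀ {a b c}, a ∈ carrier → b ∈ carrier → Col a b c → c ∈ carrier
  one_notMem : 1 ∉ carrier
  exists_mem : ∀ {p q}, p ∉ carrier → q ∉ carrier → ∃ m ∈ carrier, Col p q m

/-- A maximal subspace not containing the point `1` is a hyperplane. -/
theorem Hyperplane.nonempty (H : Type*) [Hyperring H] [Hyperring.IsIdempotent H] :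
    Nonempty (Hyperplane H) := by
  let S : Set (Set H) :=
    {M | 0 ∈ M ∧ (∀ a ∈ M, ∀ b ∈ M, ∀ c, Col a b c → c ∈ M) ∧ 1 ∉ M}
  have h0 : {0} ∈ S := by
    refine ⟨rfl, ?_, fun h => Hyperring.zero_ne_one (R := H) (Eq.symm h)⟩
    rintro _ rfl _ rfl c hc
    exact col_zero_left.1 hc
  obtain ⟨M, -, hM, hmax⟩ := zorn_subset_nonempty S (fun C hC hchain hne => by
    refine ⟨⋃₀ C, ⟨?_, ?_, ?_⟩, fun s hs => Set.subset_sUnion_of_mem hs⟩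
    · obtain ⟨s, hs⟩ := hne
      exact ⟨s, hs, (hC hs).1⟩
    · rintro a ⟨s, hs, ha⟩ b ⟨t, ht, hb⟩ c hc
      rcases hchain.total hs ht with h | h
      · exact ⟨t, ht, (hC ht).2.1 a (h ha) b hb c hc⟩
      · exact ⟨s, hs, (hC hs).2.1 a ha b (h hb) c hc⟩
    · rintro ⟨s, hs, h1⟩
      exact (hC hs).2.2 h1) {0} h0
  obtain ⟨hM0, hMadd, hM1⟩ := hM
  -- by maximality the subspace spanned by `M` and a point outside it contains `1`
  have key : ∀ p ∉ M, ∃ m ∈ M, Col m p 1 := by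
    intro p hp
    let N : Set H := M ∪ {z | ∃ m ∈ M, Col m p z}
    have hpN : p ∈ N := Or.inr ⟨0, hM0, col_zero_left.2 rfl⟩
    by_contra! hcon
    have hN : N ∈ S := by
      -- closure of `N` under sums of an element of `M` and one of `m + p`
      have mixed : ∀ a ∈ M, ∀ m ∈ M, ∀ b c, Col m p b → Col a b c → c ∈ N := by
        intro a ha m hm b c hb hc
        obtain ⟨u, hu, hu'⟩ := Col.transpose hc.swap_right hb
        exact Or.inr ⟨u, hMadd a ha m hm u hu, hu'.rot'.swap⟩
      refine ⟨Or.inl hM0, ?_, ?_⟩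
      · rintro a (ha | ⟨m, hm, ha⟩) b (hb | ⟨n, hn, hb⟩) c hc
        · exact Or.inl (hMadd a ha b hb c hc)
        · exact mixed a ha n hn b c hb hc
        · exact mixed b hb m hm a c ha hc.swap
        · obtain ⟨t, ht, ht'⟩ := Col.transpose ha.swap_right hb.swap_right
          have htM := hMadd m hm n hn t ht
          rcases Col.line hc ht' with rfl | h
          · exact Or.inl htM
          · exact mixed t htM m hm a c ha h.rot'
      · rintro (h | ⟨m, hm, h⟩)
        · exact hM1 h
        · exact hcon m hm h
    exact hp (hmax hN Set.subset_union_left hpN)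
  refine ⟨⟨M, hM0, fun ha hb h => hMadd _ ha _ hb _ h, hM1, fun {p q} hp hq => ?_⟩⟩
  obtain ⟨m, hm, h⟩ := key p hp
  obtain ⟨n, hn, h'⟩ := key q hq
  obtain ⟨t, ht, ht'⟩ := Col.transpose h h'
  exact ⟨t, hMadd m hm n hn t ht, ht'⟩

/-! ### The affine space off a hyperplane -/

namespace Hyperplane

variable {H : Type*} [Hyperring H] (M : Hyperplane H)

/-- The affine space that is the complement of the hyperplane at infinity `M`. -/
def Affine : Type _ := {x : H // x ∉ M.carrier}

instance : CoeOut M.Affine H := ⟨Subtype.val⟩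

/-- The base point of the affine space. -/
def base : M.Affine := ⟨1, M.one_notMem⟩

variable {M}

/-- The direction of the line `xy`: its point at infinity, or `0` if `x = y`. -/
noncomputable def dir (x y : M.Affine) : H := (M.exists_mem x.2 y.2).choose

theorem dir_mem (x y : M.Affine) : dir x y ∈ M.carrier := (M.exists_mem x.2 y.2).choose_spec.1

theorem col_dir (x y : M.Affine) : Col (x : H) y (dir x y) :=
  (M.exists_mem x.2 y.2).choose_spec.2

theorem coe_ne_zero (x : M.Affine) : (x : H) ≠ 0 := fun h => x.2 (h ▸ M.zero_mem)

theorem coe_ne_of_mem (x : M.Affine) {m : H} (hm : m ∈ M.carrier) : m ≠ x :=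
  fun h => x.2 (h ▸ hm)

variable [Hyperring.IsIdempotent H]

theorem dir_eq_of_col {x y : M.Affine} {m : H} (hm : m ∈ M.carrier) (h : Col (x : H) y m) :
    dir x y = m := by
  rcases Col.line (col_dir x y) h with h | h
  · exact h
  · exact absurd (M.add_mem (dir_mem x y) hm h) x.2

@[simp]
theorem dir_self (x : M.Affine) : dir x x = 0 :=
  dir_eq_of_col M.zero_mem (col_zero_right.2 rfl)

theorem dir_comm (x y : M.Affine) : dir x y = dir y x :=
  dir_eq_of_col (dir_mem y x) (col_dir y x).swap

theorem dir_eq_zero {x y : M.Affine} : dir x y = 0 ↔ x = y := by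
  refine ⟨fun h => Subtype.ext ?_, fun h => h ▸ dir_self x⟩
  exact col_zero_right.1 (h ▸ col_dir x y)

theorem dir_ne_zero {x y : M.Affine} (h : x ≠ y) : dir x y ≠ 0 := mt dir_eq_zero.1 h

/-- Chasles' relation, with values in the hyperaddition. -/
theorem col_dir_dir (x y z : M.Affine) : Col (dir x y) (dir y z) (dir x z) := by
  obtain ⟨m, hm, h⟩ := Col.transpose (col_dir x y).swap_right (col_dir y z).rot'
  rwa [dir_eq_of_col (M.add_mem (dir_mem x y) (dir_mem y z) h) hm]

/-- Lines through `x` and `y` with directions `m` and `n` meet if `m`, `n` and the direction of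
`xy` are collinear. -/
theorem exists_dir_eq {x y : M.Affine} {m n : H} (hm : m ∈ M.carrier) (hn : n ∈ M.carrier)
    (h : Col m n (dir x y)) : ∃ p : M.Affine, dir x p = m ∧ dir y p = n := by
  obtain ⟨p, hp, hp'⟩ := Col.transpose (col_dir x y) h
  have hpM : p ∉ M.carrier := fun h => x.2 (M.add_mem hm h hp.rot')
  exact ⟨⟨p, hpM⟩, dir_eq_of_col hm hp.swap_right, dir_eq_of_col hn hp'.swap_right⟩

/-- Two lines with distinct directions have at most one common point. -/
theorem eq_of_dir_eq {x y p q : M.Affine} (hx : dir x p = dir x q) (hy : dir y p = dir y q)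
    (hxy : dir x p ≠ dir y p) : p = q := by
  rw [← dir_eq_zero]
  have h₁ := col_dir_dir p x q
  have h₂ := col_dir_dir p y q
  rw [dir_comm p x, ← hx, col_self_iff] at h₁
  rw [dir_comm p y, ← hy, col_self_iff] at h₂
  grind

theorem dir_eq_of_col_coe {x y z : M.Affine} (h : Col (x : H) y z) : dir x y = dir x z := by
  rcases Col.line (col_dir x y) h with h | h
  · exact absurd (h ▸ dir_mem x y) z.2
  · exact (dir_eq_of_col (dir_mem x y) h.rot.rot.rot.swap_outer).symm

/-- If the lines `xy` and `xz` have the same direction, then `yz` is this line too. -/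
theorem dir_eq_of_dir_eq {x y z : M.Affine} (h : dir x y = dir x z) (hyz : y ≠ z) :
    dir y z = dir x y := by
  have h₁ := col_dir_dir y x z
  rw [dir_comm y x, ← h, col_self_iff] at h₁
  exact h₁.resolve_left (dir_ne_zero hyz)

theorem indep_coe {x y z : M.Affine} (hxy : x ≠ y) (hxz : x ≠ z) (h : dir x y ≠ dir x z) :
    Indep (x : H) y z :=
  ⟨coe_ne_zero x, coe_ne_zero y, coe_ne_zero z, fun h => hxy (Subtype.ext h),
    fun h => hxz (Subtype.ext h), fun h' => h (congrArg _ (Subtype.ext h')),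
    fun h' => h (dir_eq_of_col_coe h')⟩

theorem indep_coe_of_mem {m : H} (hm : m ∈ M.carrier) (hm0 : m ≠ 0) {y z : M.Affine} (hyz : y ≠ z)
    (h : dir y z ≠ m) : Indep m y z :=
  ⟨hm0, coe_ne_zero y, coe_ne_zero z, coe_ne_of_mem y hm, coe_ne_of_mem z hm,
    fun h => hyz (Subtype.ext h), fun h' => h (dir_eq_of_col hm h'.rot')⟩

end Hyperplane

namespace Hyperplane

variable {H : Type*} [Hyperring H] [Hyperring.IsDesarguesianSpace H] {M : Hyperplane H}

/-- The affine form of Desargues' theorem: if two triangles are in perspective from `o` and two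
pairs of corresponding sides are parallel, then so is the third. -/
theorem dir_eq_of_desargues {o : H} {a x y a' x' y' : M.Affine}
    (hox : Indep o a x) (hxy : Indep o x y) (hoy : Indep o a y)
    (hox' : Indep o a' x') (hxy' : Indep o x' y') (hoy' : Indep o a' y')
    (haa : a ≠ a') (hxx : x ≠ x') (hyy : y ≠ y')
    (hoa : Col o a a') (hoxx : Col o x x') (hoyy : Col o y y')
    (h₁ : dir a x = dir a' x') (h₂ : dir a y = dir a' y') : dir x y = dir x' y' := by
  have ne : ∀ {p q : M.Affine}, Indep o p q → p ≠ q := fun h h' => h.2.2.2.2.2.1 (congrArg _ h')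
  by_cases h : dir a x = dir a y
  · rw [dir_eq_of_dir_eq h (ne hxy), dir_eq_of_dir_eq (h₁ ▸ h₂ ▸ h) (ne hxy'), h₁]
  -- the third pair of sides meets since `o` is on both `xx'` and `yy'`
  obtain ⟨c, hc, hc'⟩ := Col.transpose hoxx.rot' hoyy.rot'
  have hcM : c ∈ M.carrier := by
    rcases Hyperring.IsDesarguesianSpace.desargues o a x y a' x' y' (dir a x) c (dir a y)
      hox hxy hoy (indep_coe (ne hox) (ne hoy) h)
      hox' hxy' hoy' (indep_coe (ne hox') (ne hoy') (h₁ ▸ h₂ ▸ h))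
      (fun h => haa (Subtype.ext h)) (fun h => hxx (Subtype.ext h))
      (fun h => hyy (Subtype.ext h)) hoa hoxx hoyy (col_dir a x) (h₁ ▸ col_dir a' x')
      hc hc' (col_dir a y) (h₂ ▸ col_dir a' y') with h' | h' | h' | h'
    · exact h' ▸ dir_mem a x
    · exact absurd h' h
    · exact h' ▸ dir_mem a y
    · exact M.add_mem (dir_mem a x) (dir_mem a y) h'.swap_right
  rw [dir_eq_of_col hcM hc, dir_eq_of_col hcM hc']

theorem exists_mem_ne (M : Hyperplane H) (c : H) : ∃ n ∈ M.carrier, n ≠ 0 ∧ n ≠ c := by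
  obtain ⟨x, hx0, hx1, hxc, hx⟩ := Hyperring.IsDesarguesianSpace.exists_indep 1 c
  by_cases hxM : x ∈ M.carrier
  · exact ⟨x, hxM, hx0, hxc⟩
  · refine ⟨dir M.base ⟨x, hxM⟩, dir_mem _ _, dir_ne_zero fun h => hx1 ?_, fun h => hx ?_⟩
    · exact (congrArg Subtype.val h).symm
    · exact h ▸ (col_dir M.base ⟨x, hxM⟩).swap_right

theorem exists_mem_ne_ne {m n : H} (hm : m ∈ M.carrier) (hn : n ∈ M.carrier) :
    ∃ k ∈ M.carrier, k ≠ 0 ∧ k ≠ m ∧ k ≠ n := by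
  classical
  by_cases h : m = 0 ∨ n = 0 ∨ m = n
  · obtain ⟨k, hk, hk0, hk'⟩ := exists_mem_ne M (if m = 0 then n else m)
    exact ⟨k, hk, by grind⟩
  · push Not at h
    obtain ⟨k, hk⟩ := exists_col m n
    exact ⟨k, M.add_mem hm hn hk, hk.ne_zero h.2.2, hk.ne_left h.2.1 h.2.2,
      hk.swap.ne_left h.1 (Ne.symm h.2.2)⟩

end Hyperplane

/-! ### Translations from Desargues' theorem -/

namespace Hyperplane

variable {H : Type*} [Hyperring H] {M : Hyperplane H}

/-- A translation: a map preserving directions and moving all points in the same direction. -/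
@[ext]
structure Translation (M : Hyperplane H) where
  toFun : M.Affine → M.Affine
  dir_map' : ∀ x y, dir (toFun x) (toFun y) = dir x y
  dir_const' : ∀ x y, dir x (toFun x) = dir y (toFun y)

namespace Translation

instance : CoeFun M.Translation fun _ => M.Affine → M.Affine := ⟨toFun⟩

theorem dir_map (f : M.Translation) (x y : M.Affine) : dir (f x) (f y) = dir x y := f.dir_map' x y

theorem dir_const (f : M.Translation) (x y : M.Affine) : dir x (f x) = dir y (f y) :=
  f.dir_const' x y

end Translation

variable [Hyperring.IsDesarguesianSpace H]

theorem exists_two_dir_eq (x : M.Affine) {n : H} (hn : n ∈ M.carrier) (hn0 : n ≠ 0) :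
    ∃ p q : M.Affine, dir x p = n ∧ dir x q = n ∧ p ≠ q := by
  obtain ⟨p, q, hp, hq, hpq⟩ := exists_two_col (coe_ne_zero x) hn0 (coe_ne_of_mem x hn).symm
  have key : ∀ {r : H}, Col (x : H) n r → r ∉ M.carrier := fun h hr => x.2 (M.add_mem hn hr h.rot')
  exact ⟨⟨p, key hp⟩, ⟨q, key hq⟩, dir_eq_of_col hn hp.swap_right, dir_eq_of_col hn hq.swap_right,
    fun h => hpq (congrArg Subtype.val h)⟩

/-- Being on a line of direction `c` is an equivalence relation. -/
theorem equivalence_dir (c : H) :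
    Equivalence fun x y : M.Affine => dir x y = 0 ∨ dir x y = c := by
  refine ⟨fun x => Or.inl (dir_self x), fun {x y} h => by rwa [dir_comm], fun {x y z} h₁ h₂ => ?_⟩
  have h := col_dir_dir x y z
  rcases h₁ with h₁ | h₁ <;> rcases h₂ with h₂ | h₂ <;> rw [h₁, h₂] at h
  · exact Or.inl (col_zero_left.1 h)
  · exact Or.inr (col_zero_left.1 h)
  · exact Or.inr (col_zero_mid.1 h).symm
  · exact col_self_iff.1 h

namespace Translation

/-- The identity translation. -/
def id (M : Hyperplane H) : M.Translation := ⟨fun x => x, fun _ _ => rfl, fun x y => by simp⟩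

/-- Two points are matched by a translation; this is Desargues' theorem with centre at infinity. -/
theorem exists_apply_eq (a a' : M.Affine) : ∃ f : M.Translation, f a = a' := by
  by_cases haa : a = a'
  · exact ⟨id M, haa⟩
  obtain ⟨c, hc⟩ : ∃ c, dir a a' = c := ⟨_, rfl⟩
  have hcM : c ∈ M.carrier := hc ▸ dir_mem a a'
  have hc0 : c ≠ 0 := hc ▸ dir_ne_zero haa
  have hE := equivalence_dir (M := M) c
  have hthree : ∀ a b : M.Affine, ∃ g, ¬ (dir a g = 0 ∨ dir a g = c) ∧
      ¬ (dir b g = 0 ∨ dir b g = c) := by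
    intro a b
    obtain ⟨n, hn, hn0, hnc⟩ := exists_mem_ne M c
    obtain ⟨p, q, hp, hq, hpq⟩ := exists_two_dir_eq a hn hn0
    by_cases hbp : dir b p = 0 ∨ dir b p = c
    · refine ⟨q, by grind, fun hbq => ?_⟩
      have h := hE.trans (hE.symm hbp) hbq
      rw [dir_eq_of_dir_eq (hp.trans hq.symm) hpq, hp] at h
      grind
    · exact ⟨p, by grind, hbp⟩
  have hne : ∀ {x x' : M.Affine}, dir x x' = c → x ≠ x' :=
    fun h h' => hc0 (h.symm.trans (dir_eq_zero.2 h'))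
  obtain ⟨φ, hφ, hφc, hφQ⟩ := exists_glued_map (fun x y : M.Affine => dir x y = 0 ∨ dir x y = c) hE
    (fun x x' => dir x x' = c)
    (fun x x' y y' => dir x x' = c ∧ dir y y' = c ∧ dir x y = dir x' y' ∧ dir x y ≠ 0 ∧
      dir x y ≠ c) (fun h => h.2.1)
    (fun {x x' y y'} h => ⟨h.2.1, h.1, by rw [dir_comm y, dir_comm y', h.2.2.1],
      by rw [dir_comm]; exact h.2.2.2⟩)
    (fun {x x' y} h hy => by
      obtain ⟨y', h₁, h₂⟩ := exists_dir_eq (x := y) (y := x') hcM (dir_mem x y) (by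
        have := col_dir_dir y x x'
        rw [h, dir_comm y x] at this
        exact this.swap)
      exact ⟨y', h, h₁, h₂.symm, by grind⟩)
    (fun {x x' y y' y''} h h' => by
      refine eq_of_dir_eq (h.2.1.trans h'.2.1.symm) (h.2.2.1.symm.trans h'.2.2.1) ?_
      rw [h.2.1, ← h.2.2.1]
      exact h.2.2.2.2.symm)
    (fun {x x' y y' z z'} h h' hyz => by
      push Not at hyz
      have ind : ∀ {p q : M.Affine}, dir p q ≠ 0 → dir p q ≠ c → Indep c p q := fun h h' =>
        indep_coe_of_mem hcM hc0 (mt dir_eq_zero.2 h) h'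
      have hcol : ∀ {p q : M.Affine}, dir p q = c → Col c (p : H) q := fun h =>
        (h ▸ col_dir _ _).rot
      refine ⟨h.2.1, h'.2.1, ?_, hyz⟩
      -- `y'` and `z'` are not on a line through `c`, since `y` and `z` are not
      have hyz' : dir y' z' ≠ 0 ∧ dir y' z' ≠ c := by
        rw [← not_or] at hyz ⊢
        exact fun hE' => hyz (hE.trans (Or.inr h.2.1)
          (hE.trans hE' (hE.symm (Or.inr h'.2.1))))
      exact dir_eq_of_desargues (o := c) (ind h.2.2.2.1 h.2.2.2.2) (ind hyz.1 hyz.2)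
        (ind h'.2.2.2.1 h'.2.2.2.2) (ind (h.2.2.1 ▸ h.2.2.2.1) (h.2.2.1 ▸ h.2.2.2.2))
        (ind hyz'.1 hyz'.2)
        (ind (h'.2.2.1 ▸ h'.2.2.2.1) (h'.2.2.1 ▸ h'.2.2.2.2))
        (hne h.1) (hne h.2.1) (hne h'.2.1) (hcol h.1) (hcol h.2.1) (hcol h'.2.1)
        h.2.2.1 h'.2.2.1)
    hthree hc
  refine ⟨⟨φ, fun x y => ?_, fun x y => (hφc x).trans (hφc y).symm⟩, hφ⟩
  by_cases hxy : x = y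
  · subst hxy; simp
  by_cases hc' : dir x y = c
  · -- the points `x`, `y` and their images are on a line through `c`
    have h₁ := hE.trans (hE.symm (Or.inr (hφc x))) (hE.trans (Or.inr hc') (Or.inr (hφc y)))
    rcases h₁ with h₁ | h₁
    · obtain ⟨z, hz, hz'⟩ := hthree x y
      have h₂ := (hφQ x z hz).2.2.1
      rw [dir_eq_zero.1 h₁, ← (hφQ y z hz').2.2.1, dir_comm x, dir_comm y] at h₂
      have h₃ := dir_eq_of_dir_eq h₂ hxy
      rw [dir_comm z] at h₃
      exact absurd (Or.inr (h₃.symm.trans hc')) hz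
    · rw [h₁, hc']
  · exact (hφQ x y (by simp [dir_eq_zero, hxy, hc'])).2.2.1.symm

/-- A translation is determined by the image of one point. -/
theorem ext_apply {f g : M.Translation} {a : M.Affine} (h : f a = g a) : f = g := by
  have hdir : ∀ x, dir x (f x) = dir x (g x) := fun x => by
    rw [f.dir_const x a, g.dir_const x a, h]
  have key : ∀ a x : M.Affine, f a = g a → dir a x ≠ dir x (f x) → f x = g x := by
    intro a x h hne
    refine eq_of_dir_eq (x := x) (y := f a) (hdir x) ?_ ?_
    · rw [f.dir_map, h, g.dir_map]
    · rw [f.dir_map]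
      exact hne.symm
  refine Translation.ext (funext fun x => ?_)
  by_cases hx : dir a x = dir x (f x)
  · -- on the line through `a` along which points move, use an auxiliary point off it
    by_cases hax : a = x
    · exact hax ▸ h
    obtain ⟨n, hn, hn0, hn'⟩ := exists_mem_ne M (dir x (f x))
    obtain ⟨y, hy, -⟩ := exists_dir_eq (x := a) (y := a) hn hn (by
      rw [dir_self, col_zero_right])
    refine key y x (key a y h ?_) fun h' => hn' ?_
    · rwa [hy, f.dir_const y x]
    · have := col_dir_dir a x y
      rw [dir_comm x y, h', ← hx, hy, col_self_iff, hx] at this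
      exact this.resolve_left hn0
  · exact key a x h hx

end Translation

end Hyperplane

/-! ### The group of translations -/

namespace Hyperplane

variable {H : Type*} [Hyperring H] {M : Hyperplane H}

namespace Translation

/-- The direction of a translation, zero for the identity. -/
noncomputable def direction (f : M.Translation) : H := dir M.base (f M.base)

theorem direction_mem (f : M.Translation) : f.direction ∈ M.carrier := dir_mem _ _

theorem dir_apply (f : M.Translation) (x : M.Affine) : dir x (f x) = f.direction :=
  f.dir_const x M.base

variable [Hyperring.IsDesarguesianSpace H]

/-- Translations in different directions commute: both composites complete a parallelogram. -/
theorem apply_comm_of_ne {f g : M.Translation} {x : M.Affine} (h : dir x (f x) ≠ dir x (g x)) :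
    f (g x) = g (f x) := by
  refine eq_of_dir_eq (x := f x) (y := g x) ?_ ?_ ?_
  · rw [f.dir_map, g.dir_const (f x) x]
  · rw [g.dir_map, f.dir_const (g x) x]
  · rw [f.dir_map, f.dir_const (g x) x]
    exact h.symm

/-- The composition of two translations. That it moves all points in the same direction is seen by
conjugating with a translation that commutes with both. -/
def comp (f g : M.Translation) : M.Translation where
  toFun x := f (g x)
  dir_map' x y := by rw [f.dir_map, g.dir_map]
  dir_const' := by
    have key : ∀ x y, dir x y ≠ dir x (f x) → dir x y ≠ dir x (g x) →
        dir x (f (g x)) = dir y (f (g y)) := by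
      intro x y hf hg
      obtain ⟨t, rfl⟩ := exists_apply_eq x y
      have h₁ : t (f (g x)) = f (t (g x)) :=
        apply_comm_of_ne (by rwa [t.dir_const _ x, f.dir_const _ x])
      rw [← apply_comm_of_ne hg, ← h₁, t.dir_map]
    intro x y
    by_cases hx : x = y
    · rw [hx]
    by_cases h : dir x y ≠ dir x (f x) ∧ dir x y ≠ dir x (g x)
    · exact key x y h.1 h.2
    -- go through a point `z` off the two lines through `x` that are moved along themselves
    obtain ⟨k, hk, hk0, hkf, hkg⟩ := exists_mem_ne_ne (dir_mem x (f x)) (dir_mem x (g x))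
    have hkn : k ≠ dir x y := by grind
    obtain ⟨p, q, hp, hq, hpq⟩ := exists_two_col hk0 (dir_ne_zero hx) hkn
    have hpn := hp.swap.ne_left hk0 hkn.symm
    have hqn := hq.swap.ne_left hk0 hkn.symm
    obtain ⟨r, hr, hrf, hrg⟩ : ∃ r, Col k (dir x y) r ∧ r ≠ dir x (f x) ∧ r ≠ dir x (g x) := by
      by_cases h' : p ≠ dir x (f x) ∧ p ≠ dir x (g x)
      · exact ⟨p, hp, h'⟩
      · exact ⟨q, hq, by grind⟩
    obtain ⟨z, hz, hz'⟩ := exists_dir_eq (x := x) (y := y) hk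
      (M.add_mem hk (dir_mem x y) hr) hr.swap_right
    rw [dir_comm] at hz'
    rw [key x z (by rwa [hz]) (by rwa [hz]),
      key z y (by rwa [hz', f.dir_const z x]) (by rwa [hz', g.dir_const z x])]

instance : Add M.Translation := ⟨comp⟩

instance : Zero M.Translation := ⟨id M⟩

noncomputable instance : Neg M.Translation :=
  ⟨fun f => (exists_apply_eq (f M.base) M.base).choose⟩

@[simp]
theorem add_apply (f g : M.Translation) (x : M.Affine) : (f + g) x = f (g x) := rfl

theorem neg_apply (f : M.Translation) : (-f) (f M.base) = M.base :=
  (exists_apply_eq (f M.base) M.base).choose_spec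

theorem add_comm' (f g : M.Translation) : f + g = g + f := by
  have key : ∀ f g : M.Translation, dir M.base (f M.base) ≠ dir M.base (g M.base) →
      f + g = g + f := fun f g h =>
    ext_apply (a := M.base) (apply_comm_of_ne h)
  by_cases h : dir M.base (f M.base) = dir M.base (g M.base)
  · -- compare with a translation `t` in a different direction
    obtain ⟨n, hn, hn0, hnf⟩ := exists_mem_ne M (dir M.base (f M.base))
    obtain ⟨x, hx, -⟩ := exists_dir_eq (x := M.base) (y := M.base) hn hn (by
      rw [dir_self, col_zero_right])
    obtain ⟨t, rfl⟩ := exists_apply_eq M.base x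
    have h₁ : f + t = t + f := key f t (by rw [hx]; exact hnf.symm)
    have h₂ : f + (g + t) = (g + t) + f := key f (g + t) fun h' => by
      have := col_dir_dir M.base (t M.base) (g (t M.base))
      rw [hx, g.dir_const (t M.base) M.base, ← h,
        show dir M.base (g (t M.base)) = dir M.base (f M.base) from h'.symm] at this
      exact (col_self_iff.1 this.rot').elim hn0 hnf
    refine ext_apply (a := t M.base) ?_
    change (f + (g + t)) M.base = (g + (f + t)) M.base
    rw [h₂, h₁]
    rfl
  · exact key f g h

noncomputable instance : AddCommGroup M.Translation where
  add_assoc _ _ _ := rfl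
  zero_add _ := rfl
  add_zero _ := rfl
  nsmul := nsmulRec
  zsmul := zsmulRec
  neg_add_cancel f := ext_apply (a := M.base) (neg_apply f)
  add_comm := add_comm'

theorem direction_eq_zero {f : M.Translation} : f.direction = 0 ↔ f = 0 := by
  refine ⟨fun h => ext_apply (a := M.base) (dir_eq_zero.1 h).symm, ?_⟩
  rintro rfl
  exact dir_self _

theorem col_direction (f g : M.Translation) :
    Col f.direction g.direction (f + g).direction := by
  have := col_dir_dir M.base (g M.base) (f (g M.base))
  rw [dir_apply, dir_apply] at this
  exact this.swap

theorem direction_sub (f g : M.Translation) :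
    (f - g).direction = dir (f M.base) (g M.base) := by
  rw [dir_comm, ← dir_apply (f - g) (g M.base), ← add_apply, sub_add_cancel]

end Translation

end Hyperplane

/-! ### Charts and their scalars -/

/-- A map from an abelian group to a hyperring that behaves like the map from a vector space onto
a subspace of the projective geometry, taking a vector to its class: `π` vanishes only at `0`, it is
additive in the hyperaddition, with any sum of classes realized by vectors, and its nonzero values
are at least three in number. The scalars are not part of the data. -/
class Chart {H V : Type*} [Hyperring H] [AddCommGroup V] (π : V → H) : Prop where
  map_eq_zero : ∀ {v}, π v = 0 ↔ v = 0
  col_add : ∀ v w, Col (π v) (π w) (π (v + w))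
  exists_sub : ∀ u v w, Col (π u) (π v) (π w) → ∃ u', π u' = π u ∧ π (v - u') = π w
  exists_ne_ne : ∀ v w, ∃ z, z ≠ 0 ∧ π z ≠ π v ∧ π z ≠ π w

namespace Chart

variable {H V V' : Type*} [Hyperring H] [AddCommGroup V] [AddCommGroup V'] (π : V → H) [Chart π]
  (π' : V' → H) [Chart π']

theorem exists_ne (v : V) : ∃ z, z ≠ 0 ∧ π z ≠ π v :=
  let ⟨z, hz, h, _⟩ := exists_ne_ne (π := π) v v
  ⟨z, hz, h⟩

theorem map_zero : π 0 = 0 := map_eq_zero.2 rfl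

variable {π} in
/-- A vector lying up to zero in two different classes vanishes. -/
theorem eq_zero_of_ne {v : V} {a b : H} (ha : π v = 0 ∨ π v = a) (hb : π v = 0 ∨ π v = b)
    (hab : a ≠ b) : v = 0 := by
  rw [← map_eq_zero (π := π)]
  grind

variable {π} in
theorem map_ne_zero {v : V} (hv : v ≠ 0) : π v ≠ 0 := mt map_eq_zero.1 hv

variable [Hyperring.IsIdempotent H]

theorem map_neg (v : V) : π (-v) = π v := by
  have := col_add (π := π) v (-v)
  rw [add_neg_cancel, map_zero π, col_zero_right] at this
  exact this.symm

theorem col_sub (v w : V) : Col (π v) (π w) (π (v - w)) := by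
  have := col_add (π := π) v (-w)
  rwa [map_neg π, ← sub_eq_add_neg] at this

theorem map_sub_comm (v w : V) : π (v - w) = π (w - v) := by
  rw [← map_neg π, neg_sub]

variable {π}

theorem eq_zero_or_of_eq {v w : V} {a : H} (hv : π v = 0 ∨ π v = a) (hw : π w = 0 ∨ π w = a) :
    π (v + w) = 0 ∨ π (v + w) = a := by
  have h := col_add (π := π) v w
  rcases hv with hv | hv <;> rcases hw with hw | hw <;> rw [hv, hw] at h
  · exact Or.inl (col_zero_left.1 h)
  · exact Or.inr (col_zero_left.1 h)
  · exact Or.inr (col_zero_mid.1 h).symm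
  · exact col_self_iff.1 h

theorem sub_eq_zero_or_of_eq {v w : V} {a : H} (hv : π v = 0 ∨ π v = a)
    (hw : π w = 0 ∨ π w = a) : π (v - w) = 0 ∨ π (v - w) = a := by
  rw [sub_eq_add_neg]
  exact eq_zero_or_of_eq hv (by rwa [map_neg π])

theorem map_add_ne_left {v w : V} (hw : w ≠ 0) (h : π v ≠ π w) : π (v + w) ≠ π v :=
  (col_add v w).ne_left (map_ne_zero hw) h

theorem map_add_ne_right {v w : V} (hv : v ≠ 0) (h : π v ≠ π w) : π (v + w) ≠ π w :=
  (col_add v w).swap.ne_left (map_ne_zero hv) h.symm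

theorem add_ne_zero {v w : V} (h : π v ≠ π w) : v + w ≠ 0 := by
  rw [Ne, ← map_eq_zero (π := π)]
  exact (col_add v w).ne_zero h

variable {π'}

/-- A map preserving the classes of the vectors and of their differences is additive. -/
theorem map_add_of_map_sub {φ : V → V'} (h0 : φ 0 = 0) (hφ : ∀ v, π' (φ v) = π v)
    (hsub : ∀ v w, v ≠ 0 → w ≠ 0 → π v ≠ π w → π' (φ v - φ w) = π (v - w)) (v w : V) :
    φ (v + w) = φ v + φ w := by
  have indep : ∀ {v w : V}, v ≠ 0 → w ≠ 0 → π v ≠ π w → φ (v + w) = φ v + φ w := by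
    intro v w hv hw h
    have h₁ := hsub (v + w) v (add_ne_zero h) hv (map_add_ne_left hw h)
    have h₂ := hsub (v + w) w (add_ne_zero h) hw (map_add_ne_right hv h)
    rw [add_sub_cancel_left] at h₁
    rw [add_sub_cancel_right] at h₂
    rw [← sub_eq_zero]
    refine eq_zero_of_ne (π := π') (a := π v) (b := π w) ?_ ?_ h
    · rw [show φ (v + w) - (φ v + φ w) = φ (v + w) - φ w - φ v by abel]
      exact sub_eq_zero_or_of_eq (Or.inr h₂) (Or.inr (hφ v))
    · rw [show φ (v + w) - (φ v + φ w) = φ (v + w) - φ v - φ w by abel]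
      exact sub_eq_zero_or_of_eq (Or.inr h₁) (Or.inr (hφ w))
  by_cases hv : v = 0
  · simp [hv, h0]
  by_cases hw : w = 0
  · simp [hw, h0]
  by_cases h : π v = π w
  · -- compare both sides after adding a vector `z` of another class
    obtain ⟨z, hz, hzv⟩ := exists_ne π v
    have hwz : π w ≠ π z := fun h' => hzv (h'.symm.trans h.symm)
    have h₁ : φ (v + (w + z)) = φ v + φ (w + z) :=
      indep hv (add_ne_zero hwz) fun h' => map_add_ne_left hz hwz (h'.symm.trans h)
    rw [indep hw hz hwz, ← add_assoc] at h₁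
    have h₂ : φ (v + w + z) = φ (v + w) + φ z := by
      by_cases hvw : v + w = 0
      · simp [hvw, h0]
      · refine indep hvw hz fun h' => hzv ?_
        rcases eq_zero_or_of_eq (π := π) (Or.inr rfl) (Or.inr h.symm) with h'' | h''
        · exact absurd (map_eq_zero.1 h'') hvw
        · rw [← h', h'']
    rw [h₂, ← add_assoc] at h₁
    exact add_right_cancel h₁
  · exact indep hv hw h

variable (π π')

/-- A pair of vectors of the same class extends to an additive map preserving classes, if the
differences of classes determined by two differences are the same in both charts. -/
theorem exists_addMonoidHom (hrange : ∀ v, ∃ v', π' v' = π v)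
    (htrans : ∀ {u v w : V} {u' v' w' : V'}, u ≠ 0 → v ≠ 0 → w ≠ 0 → π' u' = π u → π' v' = π v →
      π' w' = π w → π u ≠ π v → π u ≠ π w → π v ≠ π w → π' (u' - v') = π (u - v) →
      π' (u' - w') = π (u - w) → π' (v' - w') = π (v - w))
    {e : V} {e' : V'} (he : e ≠ 0) (hee : π' e' = π e) :
    ∃ φ : V →+ V', φ e = e' ∧ ∀ v, π' (φ v) = π v := by
  classical
  obtain ⟨φ, hφe, hφm, hφQ⟩ := exists_glued_map
    (fun v w : {v : V // v ≠ 0} => π v = π w)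
    ⟨fun _ => rfl, Eq.symm, Eq.trans⟩ (fun v v' => π' v' = π v)
    (fun v v' w w' => π' v' = π v ∧ π' w' = π w ∧ π v ≠ π w ∧ π' (v' - w') = π (v - w))
    (fun h => h.2.1)
    (fun {v v' w w'} h => ⟨h.2.1, h.1, h.2.2.1.symm, by
      rw [map_sub_comm π', map_sub_comm π, h.2.2.2]⟩)
    (fun {v v' w} h hne => by
      obtain ⟨u, hu⟩ := hrange w
      obtain ⟨z, hz⟩ := hrange (v - w)
      obtain ⟨w', h₁, h₂⟩ := exists_sub (π := π') u v' z (by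
        rw [hu, hz, h]
        exact (col_sub π (v : V) w).swap)
      exact ⟨w', h, h₁.trans hu, hne, h₂.trans hz⟩)
    (fun {v v' w w' w''} h h' => by
      rw [← sub_eq_zero]
      have hv' : v' ≠ 0 := by
        rw [Ne, ← map_eq_zero (π := π'), h.1]
        exact map_ne_zero v.2
      refine eq_zero_of_ne (π := π') (a := π w) (b := π (v - w))
        (sub_eq_zero_or_of_eq (Or.inr h.2.1) (Or.inr h'.2.1)) ?_
        ((col_sub π (v : V) w).swap.ne_left (map_ne_zero v.2) h.2.2.1.symm).symm
      rw [show w' - w'' = v' - w'' - (v' - w') by abel]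
      exact sub_eq_zero_or_of_eq (Or.inr h'.2.2.2) (Or.inr h.2.2.2))
    (fun {u u' v v' w w'} h h' hne => ⟨h.2.1, h'.2.1, hne,
      htrans u.2 v.2 w.2 h.1 h.2.1 h'.2.1 h.2.2.1 h'.2.2.1 hne h.2.2.2 h'.2.2.2⟩)
    (fun v w => by
      obtain ⟨z, hz, h₁, h₂⟩ := exists_ne_ne (π := π) (v : V) w
      exact ⟨⟨z, hz⟩, h₁.symm, h₂.symm⟩)
    (a := ⟨e, he⟩) (a' := e') hee
  let ψ : V → V' := fun v => if h : v = 0 then 0 else φ ⟨v, h⟩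
  have hψ0 : ψ 0 = 0 := dif_pos rfl
  have hψ : ∀ {v} (h : v ≠ 0), ψ v = φ ⟨v, h⟩ := fun h => dif_neg h
  have hψm : ∀ v, π' (ψ v) = π v := by
    intro v
    by_cases hv : v = 0
    · rw [hv, hψ0, map_zero π, map_zero π']
    · rw [hψ hv, hφm]
  refine ⟨⟨⟨ψ, hψ0⟩, map_add_of_map_sub hψ0 hψm fun v w hv hw hvw => ?_⟩, (hψ he).trans hφe, hψm⟩
  change π' (ψ v - ψ w) = π (v - w)
  rw [hψ hv, hψ hw]
  exact (hφQ ⟨v, hv⟩ ⟨w, hw⟩ hvw).2.2.2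

/-- The ring of additive endomorphisms that map every vector into its class or to zero. -/
def scalars : Subring (AddMonoid.End V) where
  carrier := {φ | ∀ v, π (φ v) = 0 ∨ π (φ v) = π v}
  mul_mem' {φ ψ} hφ hψ v := by
    change π (φ (ψ v)) = 0 ∨ π (φ (ψ v)) = π v
    have := hφ (ψ v)
    have := hψ v
    grind
  one_mem' v := Or.inr rfl
  add_mem' {φ ψ} hφ hψ v := eq_zero_or_of_eq (hφ v) (hψ v)
  zero_mem' v := Or.inl (map_zero π)
  neg_mem' {φ} hφ v := by
    change π (-(φ v)) = 0 ∨ π (-(φ v)) = π v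
    rw [map_neg π]
    exact hφ v

end Chart

/-- A chart in which two vectors of the same class differ by a scalar. -/
class HomogeneousChart {H V : Type*} [Hyperring H] [Hyperring.IsIdempotent H] [AddCommGroup V]
    (π : V → H) : Prop extends Chart π where
  exists_scalar : ∀ v w, v ≠ 0 → π v = π w → ∃ k : Chart.scalars π, k • v = w

namespace Chart

variable {H V : Type*} [Hyperring H] [Hyperring.IsIdempotent H] [AddCommGroup V]
  {π : V → H} [Chart π]

theorem map_smul_eq (k : scalars π) (v : V) : π (k • v) = 0 ∨ π (k • v) = π v := k.2 v

/-- A nonzero scalar kills no nonzero vector: if it kills `v` then it maps `w` both into the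
class of `w` and into that of `v + w`. -/
theorem smul_eq_zero_imp {k : scalars π} {v : V} (h : k • v = 0) (hv : v ≠ 0) : k = 0 := by
  have key : ∀ {v w : V}, k • v = 0 → v ≠ 0 → π v ≠ π w → k • w = 0 := by
    intro v w h hv hvw
    have h₁ := map_smul_eq k (v + w)
    rw [smul_add, h, zero_add] at h₁
    exact eq_zero_of_ne (map_smul_eq k w) h₁ (map_add_ne_right hv hvw).symm
  refine Subtype.ext (AddMonoidHom.ext fun w => ?_)
  change k • w = 0
  by_cases hvw : π v = π w
  · obtain ⟨z, hz, hzv⟩ := exists_ne π v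
    exact key (key h hv hzv.symm) hz (hvw ▸ hzv)
  · exact key h hv hvw

end Chart

namespace HomogeneousChart

open Chart

variable {H V : Type*} [Hyperring H] [Hyperring.IsIdempotent H] [AddCommGroup V]
  {π : V → H} [HomogeneousChart π]

instance : Nontrivial (scalars π) := by
  obtain ⟨z, hz, -⟩ := exists_ne π 0
  exact ⟨⟨0, 1, fun h => hz (by rw [← one_smul (scalars π) z, ← h, zero_smul])⟩⟩

theorem exists_mul_eq_one {k : scalars π} (hk : k ≠ 0) : ∃ l, l * k = 1 ∧ k * l = 1 := by
  obtain ⟨z, hz, -⟩ := exists_ne π 0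
  have hkz : k • z ≠ 0 := fun h => hk (smul_eq_zero_imp h hz)
  obtain ⟨l, hl⟩ := exists_scalar (k • z) z hkz
    ((map_smul_eq k z).resolve_left (map_ne_zero hkz))
  have h₁ : l * k = 1 := by
    rw [← sub_eq_zero]
    refine smul_eq_zero_imp (v := z) ?_ hz
    rw [sub_smul, mul_smul, hl, one_smul, sub_self]
  refine ⟨l, h₁, ?_⟩
  rw [← sub_eq_zero]
  refine smul_eq_zero_imp (v := k • z) ?_ hkz
  rw [sub_smul, mul_smul, hl, one_smul, sub_self]

noncomputable instance : DivisionRing (scalars π) :=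
  DivisionRing.ofIsUnitOrEqZero fun k => by
    by_cases hk : k = 0
    · exact Or.inr hk
    · obtain ⟨l, h₁, h₂⟩ := exists_mul_eq_one hk
      exact Or.inl ⟨⟨k, l, h₂, h₁⟩, rfl⟩

theorem map_smul {k : scalars π} (hk : k ≠ 0) (v : V) : π (k • v) = π v := by
  by_cases hv : v = 0
  · rw [hv, smul_zero]
  · exact (map_smul_eq k v).resolve_left (map_ne_zero fun h => hk (smul_eq_zero_imp h hv))

end HomogeneousChart

/-! ### Homotheties from Desargues' theorem -/

namespace Hyperplane

variable {H : Type*} [Hyperring H] [Hyperring.IsDesarguesianSpace H] {M : Hyperplane H}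

open Chart Translation

namespace Translation

theorem exists_direction_eq {n : H} (hn : n ∈ M.carrier) :
    ∃ f : M.Translation, f.direction = n := by
  obtain ⟨x, hx, -⟩ := exists_dir_eq (x := M.base) (y := M.base) hn hn (by
    rw [dir_self, col_zero_right])
  obtain ⟨f, rfl⟩ := exists_apply_eq M.base x
  exact ⟨f, hx⟩

instance : Chart (direction : M.Translation → H) where
  map_eq_zero := direction_eq_zero
  col_add := col_direction
  exists_sub u v w h := by
    obtain ⟨p, h₁, h₂⟩ := exists_dir_eq (x := M.base) (y := v M.base) u.direction_mem
      w.direction_mem h.swap_right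
    obtain ⟨f, rfl⟩ := exists_apply_eq M.base p
    exact ⟨f, h₁, (direction_sub v f).trans h₂⟩
  exists_ne_ne u v := by
    obtain ⟨k, hk, hk0, hku, hkv⟩ := exists_mem_ne_ne u.direction_mem v.direction_mem
    obtain ⟨f, rfl⟩ := exists_direction_eq hk
    exact ⟨f, mt direction_eq_zero.2 hk0, hku, hkv⟩

/-- Scalars are homotheties with the base point as centre, which exist by Desargues' theorem. -/
instance : HomogeneousChart (direction : M.Translation → H) where
  exists_scalar e e' he hee := by
    obtain ⟨φ, hφ, hφd⟩ := exists_addMonoidHom (direction : M.Translation → H)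
      (direction : M.Translation → H) (fun v => ⟨v, rfl⟩) (fun {u v w u' v' w'} hu hv hw hu' hv' hw'
        huv huw hvw h₁ h₂ => by
      -- the image of one vector determines that of any vector of another class
      have key : ∀ {x x' y y' : M.Translation}, x ≠ 0 → direction x' = direction x →
          direction y' = direction y → direction x ≠ direction y →
          direction (x' - y') = direction (x - y) → x = x' → y = y' := by
        intro x x' y y' hx hx' hy' hxy h hxx
        subst hxx
        rw [← sub_eq_zero]
        refine eq_zero_of_ne (π := direction) (a := direction y) (b := direction (x - y))
          (sub_eq_zero_or_of_eq (Or.inr rfl) (Or.inr hy')) ?_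
          ((col_sub _ x y).swap.ne_left (map_ne_zero hx) hxy.symm).symm
        rw [show y - y' = x - y' - (x - y) by abel]
        exact sub_eq_zero_or_of_eq (Or.inr h) (Or.inr rfl)
      have base_ne : ∀ {x : M.Translation}, x ≠ 0 → M.base ≠ x M.base := fun hx h =>
        hx (ext_apply (a := M.base) h.symm)
      have ne0 : ∀ {x x' : M.Translation}, x ≠ 0 → direction x' = direction x → x' ≠ 0 :=
        fun hx h h' => map_ne_zero (π := direction) hx (h ▸ direction_eq_zero.2 h')
      have ind : ∀ {x y : M.Translation}, x ≠ 0 → y ≠ 0 → direction x ≠ direction y →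
          Indep (M.base : H) (x M.base) (y M.base) := fun hx hy h =>
        indep_coe (base_ne hx) (base_ne hy) h
      have col : ∀ {x x' : M.Translation}, x ≠ 0 → x ≠ x' → direction x' = direction x →
          Col (M.base : H) (x M.base) (x' M.base) := by
        intro x x' hx hxx h
        have h₂ := (col_dir M.base (x' M.base)).swap_right
        rw [show dir M.base (x' M.base) = dir M.base (x M.base) from h] at h₂
        rcases Col.line (col_dir M.base (x M.base)).swap_right h₂ with h' | h'
        · exact absurd (ext_apply (a := M.base) (Subtype.ext h')) hxx
        · exact h'.rot
      by_cases huu : u = u'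
      · rw [key hu hu' hv' huv h₁ huu, key hu hu' hw' huw h₂ huu]
      have hvv : v ≠ v' := fun h => huu (key hv hv' hu' huv.symm (by
        rw [map_sub_comm direction, h₁, map_sub_comm direction]) h)
      have hww : w ≠ w' := fun h => huu (key hw hw' hu' huw.symm (by
        rw [map_sub_comm direction, h₂, map_sub_comm direction]) h)
      have app : ∀ {x x' : M.Translation}, x ≠ x' → x M.base ≠ x' M.base := fun h h' =>
        h (ext_apply h')
      have hu0 := ne0 hu hu'
      have hv0 := ne0 hv hv'
      have hw0 := ne0 hw hw'
      rw [direction_sub, direction_sub] at h₁ h₂ ⊢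
      exact (dir_eq_of_desargues (ind hu hv huv) (ind hv hw hvw) (ind hu hw huw)
        (ind hu0 hv0 (hu' ▸ hv' ▸ huv)) (ind hv0 hw0 (hv' ▸ hw' ▸ hvw))
        (ind hu0 hw0 (hu' ▸ hw' ▸ huw)) (app huu) (app hvv) (app hww) (col hu huu hu')
        (col hv hvv hv') (col hw hww hw') h₁.symm h₂.symm).symm) he hee.symm
    exact ⟨⟨φ, fun v => Or.inr (hφd v)⟩, hφ⟩

end Translation

end Hyperplane

/-! ### Homogeneous coordinates -/

/-- A map from an abelian group onto a hyperring with the properties of the map that sends a vector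
to its class in projective space with `0` adjoined. -/
class Coordinates {H V : Type*} [Hyperring H] [AddCommGroup V] (π : V → H) : Prop where
  map_eq_zero : ∀ {v}, π v = 0 ↔ v = 0
  col_add : ∀ v w, Col (π v) (π w) (π (v + w))
  exists_sub : ∀ x v z, Col x (π v) z → ∃ u, π u = x ∧ π (v - u) = z

namespace Coordinates

variable {H V : Type*} [Hyperring H] [AddCommGroup V] (π : V → H) [Coordinates π]

theorem surjective : Function.Surjective π := fun x => by
  obtain ⟨u, hu, -⟩ := exists_sub (π := π) x 0 x (by
    rw [(map_eq_zero (π := π)).2 rfl, col_zero_mid])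
  exact ⟨u, hu⟩

instance [Hyperring.IsDesarguesianSpace H] : Chart π where
  map_eq_zero := map_eq_zero
  col_add := col_add
  exists_sub u v w h := exists_sub (π u) v (π w) h
  exists_ne_ne v w := by
    obtain ⟨c, hc0, hcv, hcw, -⟩ := Hyperring.IsDesarguesianSpace.exists_indep (π v) (π w)
    obtain ⟨z, rfl⟩ := surjective π c
    exact ⟨z, mt map_eq_zero.2 hc0, hcv, hcw⟩

end Coordinates

namespace Hyperplane

variable {H : Type*} [Hyperring H] [Hyperring.IsDesarguesianSpace H] (M : Hyperplane H)

open Chart Translation HomogeneousChart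

/-- The division ring of homotheties of the affine space. -/
abbrev Scalars : Type _ := scalars (direction : M.Translation → H)

open Classical in
/-- Homogeneous coordinates: `(t, 0)` stands for the point at infinity in the direction of `t`, and
`(t, k)` with `k ≠ 0` for the point to which `k⁻¹ • t` moves the base point. -/
noncomputable def point (v : M.Translation × M.Scalars) : H :=
  if v.2 = 0 then v.1.direction else ((v.2⁻¹ • v.1) M.base : M.Affine)

variable {M}

theorem point_zero (t : M.Translation) : M.point (t, 0) = t.direction := if_pos rfl

theorem point_smul (p : M.Translation) {k : M.Scalars} (hk : k ≠ 0) :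
    M.point (k • p, k) = (p M.base : M.Affine) := by
  rw [point, if_neg hk, smul_smul, inv_mul_cancel₀ hk, one_smul]

theorem exists_scalar_ne (l : M.Scalars) : ∃ k : M.Scalars, k ≠ 0 ∧ k ≠ l := by
  by_cases hl : l = 0
  · exact ⟨1, one_ne_zero, fun h => one_ne_zero (h.trans hl)⟩
  obtain ⟨n, hn, hn0, -⟩ := exists_mem_ne M 0
  obtain ⟨p, q, hp, hq, hpq⟩ := exists_two_dir_eq M.base hn hn0
  obtain ⟨f, rfl⟩ := Translation.exists_apply_eq M.base p
  obtain ⟨g, rfl⟩ := Translation.exists_apply_eq M.base q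
  have hf : f ≠ 0 := fun h => hn0 (hp ▸ direction_eq_zero.2 h)
  obtain ⟨k, hk⟩ := exists_scalar (π := direction) f g hf (hp.trans hq.symm)
  have hg : g ≠ 0 := fun h => hn0 (hq ▸ direction_eq_zero.2 h)
  refine ⟨k * l, mul_ne_zero (fun h => hg ?_) hl, fun h => hpq ?_⟩
  · rw [← hk, h, zero_smul]
  · rw [mul_eq_right₀ hl] at h
    rw [← hk, h, one_smul]

theorem exists_translation (x : H) (hx : x ∉ M.carrier) :
    ∃ p : M.Translation, (p M.base : M.Affine) = x :=
  let ⟨p, hp⟩ := Translation.exists_apply_eq M.base ⟨x, hx⟩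
  ⟨p, congrArg Subtype.val hp⟩

theorem col_apply (p q : M.Translation) :
    Col (p M.base : H) (q M.base) (p - q).direction := by
  rw [direction_sub]
  exact col_dir _ _

theorem direction_sub_eq {p q : M.Translation} {m : H} (hm : m ∈ M.carrier)
    (h : Col (p M.base : H) (q M.base) m) : (p - q).direction = m := by
  rw [direction_sub]
  exact dir_eq_of_col hm h

instance : Coordinates M.point where
  map_eq_zero {v} := by
    obtain ⟨t, k⟩ := v
    by_cases hk : k = 0
    · subst hk
      rw [point_zero, direction_eq_zero, Prod.mk_eq_zero, and_iff_left rfl]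
    · rw [point, if_neg hk]
      simp [coe_ne_zero, hk]
  col_add v w := by
    have mixed : ∀ (k : M.Scalars) (hk : k ≠ 0) (t p : M.Translation),
        Col (M.point (k • p, k)) (M.point (t, 0)) (M.point ((k • p, k) + (t, 0))) := by
      intro k hk t p
      have ht : t = k • k⁻¹ • t := by rw [smul_smul, mul_inv_cancel₀ hk, one_smul]
      rw [Prod.mk_add_mk, add_zero, point_zero]
      nth_rw 2 [ht]
      rw [← smul_add, point_smul _ hk, point_smul _ hk]
      have h := col_apply p (p + k⁻¹ • t)
      rw [map_sub_comm direction, add_sub_cancel_left, map_smul (inv_ne_zero hk)] at h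
      exact h.swap_right
    have red : ∀ (v : M.Translation × M.Scalars), v.2 ≠ 0 → ∃ p, v = (v.2 • p, v.2) :=
      fun v hv => ⟨v.2⁻¹ • v.1, by rw [smul_smul, mul_inv_cancel₀ hv, one_smul]⟩
    obtain ⟨t, k⟩ := v
    obtain ⟨s, l⟩ := w
    by_cases hk : k = 0
    · by_cases hl : l = 0
      · subst hk hl
        rw [Prod.mk_add_mk, add_zero, point_zero, point_zero, point_zero]
        exact col_direction t s
      · obtain ⟨p, hp⟩ := red (s, l) hl
        rw [hp, hk, add_comm]
        exact (mixed l hl t p).swap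
    · obtain ⟨p, hp⟩ := red (t, k) hk
      by_cases hl : l = 0
      · rw [hp, hl]
        exact mixed k hk s p
      obtain ⟨q, hq⟩ := red (s, l) hl
      rw [hp, hq]
      dsimp only
      rw [Prod.mk_add_mk, point_smul _ hk, point_smul _ hl]
      have hpq := col_apply p q
      by_cases hkl : k + l = 0
      · have hkl' : l = -k := (neg_eq_of_add_eq_zero_right hkl).symm
        rw [hkl, point_zero, hkl', neg_smul, ← sub_eq_add_neg, ← smul_sub, map_smul hk]
        exact hpq
      · obtain ⟨r, hr⟩ := red (k • p + l • q, k + l) hkl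
        have hr' : k • p + l • q = (k + l) • r := congrArg Prod.fst hr
        rw [hr', point_smul _ hkl]
        have h₁ : (k + l) • (r - p) = l • (q - p) := by
          rw [smul_sub, ← hr', add_smul, smul_sub]
          abel
        have h₂ : (r - p).direction = (q - p).direction := by
          rw [← map_smul (π := direction) hkl, h₁, map_smul hl]
        by_cases hpq' : p = q
        · subst hpq'
          rw [sub_self, direction_eq_zero.2 rfl, direction_eq_zero, sub_eq_zero] at h₂
          rw [h₂]
          exact col_self_iff.2 (Or.inr rfl)
        · have hrp := col_apply r p
          rw [h₂, map_sub_comm direction] at hrp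
          rcases Col.line hrp.swap.swap_right hpq.swap_right with h | h
          · have hrq : r = q := ext_apply (a := M.base) (Subtype.ext h)
            rw [hrq, add_smul, add_eq_right] at h₁
            refine absurd (smul_eq_zero_imp h₁ (sub_ne_zero.2 (Ne.symm hpq'))) hk
          · exact h.swap_outer
  exists_sub x v z h := by
    obtain ⟨s, l⟩ := v
    by_cases hl : l = 0
    · subst hl
      rw [point_zero] at h
      by_cases hx : x ∈ M.carrier
      · obtain ⟨t, rfl⟩ := exists_direction_eq hx
        obtain ⟨t', rfl⟩ := exists_direction_eq (M.add_mem hx s.direction_mem h)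
        obtain ⟨u, hu, hu'⟩ := exists_sub (π := direction) t s t' h
        exact ⟨(u, 0), (point_zero u).trans hu, by
          rw [Prod.mk_sub_mk, sub_zero, point_zero, hu']⟩
      · have hz : z ∉ M.carrier := fun hz => hx (M.add_mem s.direction_mem hz h.rot')
        obtain ⟨p, rfl⟩ := exists_translation x hx
        obtain ⟨q, rfl⟩ := exists_translation z hz
        have hd := direction_sub_eq s.direction_mem h.swap_right
        obtain ⟨k, hk, hks⟩ : ∃ k : M.Scalars, k ≠ 0 ∧ k • (p - q) = s := by
          by_cases hs : s = 0
          · rw [hs, direction_eq_zero.2 rfl, direction_eq_zero] at hd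
            exact ⟨1, one_ne_zero, by rw [hd, hs, smul_zero]⟩
          · have hpq : p - q ≠ 0 := fun h' => hs (by
              rwa [h', direction_eq_zero.2 rfl, eq_comm, direction_eq_zero] at hd)
            obtain ⟨k, hk⟩ := exists_scalar (π := direction) _ _ hpq hd
            exact ⟨k, fun h => hs (by rw [← hk, h, zero_smul]), hk⟩
        refine ⟨(k • p, k), point_smul p hk, ?_⟩
        rw [← hks, Prod.mk_sub_mk, smul_sub, zero_sub, sub_sub_cancel_left, ← neg_smul,
          point_smul _ (neg_ne_zero.2 hk)]
    · obtain ⟨q, rfl⟩ : ∃ q, s = l • q :=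
        ⟨l⁻¹ • s, by rw [smul_smul, mul_inv_cancel₀ hl, one_smul]⟩
      rw [point_smul q hl] at h
      by_cases hx : x ∈ M.carrier
      · have hz : z ∉ M.carrier := fun hz => (q M.base).2 (M.add_mem hz hx h.rot)
        obtain ⟨r, rfl⟩ := exists_translation z hz
        refine ⟨(l • (q - r), 0), ?_, ?_⟩
        · rw [point_zero, map_smul hl, direction_sub_eq hx h.rot']
        · rw [Prod.mk_sub_mk, sub_zero, ← smul_sub, sub_sub_cancel, point_smul _ hl]
      obtain ⟨p, rfl⟩ := exists_translation x hx
      by_cases hz : z ∈ M.carrier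
      · refine ⟨(l • p, l), point_smul p hl, ?_⟩
        rw [Prod.mk_sub_mk, sub_self, ← smul_sub, point_zero, map_smul hl, map_sub_comm direction,
          direction_sub_eq hz h]
      obtain ⟨r, rfl⟩ := exists_translation z hz
      obtain ⟨k, hk, hkl, hkr⟩ : ∃ k : M.Scalars, k ≠ 0 ∧ k ≠ l ∧ k • (p - r) = l • (q - r) := by
        have inj : ∀ {p q : M.Translation}, (p M.base : H) = q M.base → p = q := fun h =>
          ext_apply (a := M.base) (Subtype.ext h)
        by_cases hpr : p = r
        · subst hpr
          have hqp := inj ((col_self_iff.1 h.swap_right).resolve_left (coe_ne_zero _))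
          obtain ⟨k, hk, hkl⟩ := exists_scalar_ne l
          exact ⟨k, hk, hkl, by rw [hqp, sub_self, smul_zero, smul_zero]⟩
        · have hqr : q ≠ r := by
            rintro rfl
            exact hpr (inj ((col_self_iff.1 h.rot').resolve_left (coe_ne_zero _)))
          have hd : (p - r).direction = (l • (q - r)).direction := by
            rw [map_smul hl, direction_sub, direction_sub, dir_comm, dir_eq_of_col_coe h.rot,
              dir_comm]
          obtain ⟨k, hk⟩ := exists_scalar (π := direction) _ _ (sub_ne_zero.2 hpr) hd
          refine ⟨k, fun h0 => ?_, fun h0 => ?_, hk⟩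
          · rw [h0, zero_smul, eq_comm] at hk
            exact hl (smul_eq_zero_imp hk (sub_ne_zero.2 hqr))
          · rw [h0, ← sub_eq_zero, ← smul_sub, sub_sub_sub_cancel_right] at hk
            by_cases hpq : p = q
            · rw [hpq] at h
              exact hqr (inj ((col_self_iff.1 h).resolve_left (coe_ne_zero _))).symm
            · exact hl (smul_eq_zero_imp hk (sub_ne_zero.2 hpq))
      refine ⟨(k • p, k), point_smul p hk, ?_⟩
      have hlk : l - k ≠ 0 := sub_ne_zero.2 hkl.symm
      have h₁ : l • q - k • p = (l - k) • r := by
        rw [smul_sub, smul_sub, sub_eq_sub_iff_add_eq_add] at hkr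
        rw [sub_smul, sub_eq_sub_iff_add_eq_add, add_comm (l • r), hkr]
      rw [Prod.mk_sub_mk, h₁, point_smul _ hlk]

end Hyperplane

/-! ### The fundamental theorem of projective geometry -/

/-- Two distinct lines have at most one common point. Here `b`, `c` and `p`, `q` span the lines and
`a`, `b`, `c` is a triangle with `p` on the side `ab`. -/
theorem eq_of_col_of_col {H : Type*} [Hyperring H] [Hyperring.IsIdempotent H] {a b c p q x y : H}
    (hac : a ≠ c) (hbp : b ≠ p) (habp : Col a b p) (habc : ¬ Col a b c)
    (hx : Col b c x) (hy : Col b c y) (hx' : Col p q x) (hy' : Col p q y) : x = y := by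
  rcases Col.line hx hy with h | h₁
  · exact h
  rcases Col.line hx' hy' with h | h₂
  · exact h
  rcases Col.line h₁ h₂ with h | h₃
  · exact absurd h hbp
  exfalso
  rcases Col.line h₃ habp.rot' with h | h₄
  · exact habc (h ▸ hx.rot)
  · rcases Col.line hx.swap_right h₄.rot with h | h
    · exact absurd h.symm hac
    · exact habc h.rot'

namespace Chart

variable {H V V' : Type*} [Hyperring H] [Hyperring.IsIdempotent H] [AddCommGroup V]
  [AddCommGroup V'] {π : V → H} [Chart π] {π' : V' → H} [Chart π']

/-- Additive maps inducing the same injective map `c` on classes, where they do not vanish, agree as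
soon as they agree at one nonzero vector. -/
theorem addMonoidHom_ext {c : H → H} (hc : Function.Injective c) {φ ψ : V →+ V'}
    (hφ : ∀ v, π' (φ v) = 0 ∨ π' (φ v) = c (π v)) (hψ : ∀ v, π' (ψ v) = 0 ∨ π' (ψ v) = c (π v))
    {e : V} (he : e ≠ 0) (h : φ e = ψ e) : φ = ψ := by
  have hD : ∀ v, π' (φ v - ψ v) = 0 ∨ π' (φ v - ψ v) = c (π v) := fun v =>
    sub_eq_zero_or_of_eq (hφ v) (hψ v)
  have key : ∀ {v}, π v ≠ π e → φ v = ψ v := by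
    intro v hv
    rw [← sub_eq_zero]
    refine eq_zero_of_ne (hD v) (b := c (π (v - e))) ?_ (hc.ne ?_)
    · have := hD (v - e)
      rwa [_root_.map_sub, _root_.map_sub, h, sub_sub_sub_cancel_right] at this
    · exact ((col_sub π v e).ne_left (map_ne_zero he) hv).symm
  refine AddMonoidHom.ext fun v => ?_
  by_cases hv : π v = π e
  · obtain ⟨z, hz, hze⟩ := exists_ne π e
    have h₁ : φ (v + z) = ψ (v + z) := key fun h => by
      have := map_add_ne_left hz (v := v) (hv ▸ hze.symm)
      exact this (h.trans hv.symm)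
    rwa [_root_.map_add, _root_.map_add, key hze, add_left_inj] at h₁
  · exact key hv

end Chart

namespace Coordinates

open Chart

variable {H V V' : Type*} [Hyperring H] [Hyperring.IsDesarguesianSpace H] [AddCommGroup V]
  [AddCommGroup V'] (π : V → H) [Coordinates π] (π' : V' → H) [Coordinates π']

/-- The fundamental theorem of projective geometry, in the form that two coordinatizations of the
same geometry are related by an additive map. -/
theorem exists_addMonoidHom {e : V} {e' : V'} (he : e ≠ 0) (hee : π' e' = π e) :
    ∃ φ : V →+ V', φ e = e' ∧ ∀ v, π' (φ v) = π v := by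
  -- if the classes of `u`, `v`, `w` are not collinear, that of `v - w` is the intersection of two lines
  have noncol : ∀ {u v w : V} {u' v' w' : V'}, u ≠ 0 → π' v' = π v → π' w' = π w → π u ≠ π v →
      π u ≠ π w → ¬ Col (π u) (π v) (π w) → π' (u' - v') = π (u - v) → π' (u' - w') = π (u - w) →
      π' (v' - w') = π (v - w) := by
    intro u v w u' v' w' hu hv' hw' huv huw h h₁ h₂
    refine eq_of_col_of_col (q := π (u - w)) huw
      ((col_sub π u v).swap.ne_left (map_ne_zero hu) huv.symm).symm (col_sub π u v) h ?_
      (col_sub π v w) ?_ ?_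
    · rw [← hv', ← hw']
      exact col_sub π' v' w'
    · rw [← h₁, ← h₂, map_sub_comm π' v']
      have := col_sub π' (u' - v') (u' - w')
      rwa [sub_sub_sub_cancel_left] at this
    · rw [map_sub_comm π v]
      have := col_sub π (u - v) (u - w)
      rwa [sub_sub_sub_cancel_left] at this
  refine Chart.exists_addMonoidHom π π' (fun v => surjective π' _) ?_ he hee
  intro u v w u' v' w' hu hv hw hu' hv' hw' huv huw hvw h₁ h₂
  by_cases h : Col (π u) (π v) (π w)
  · -- go through a vector `z` outside the plane of `u` and `v`
    obtain ⟨c, hc0, hcu, hcv, hc⟩ := Hyperring.IsDesarguesianSpace.exists_indep (π u) (π v)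
    obtain ⟨z, rfl⟩ := surjective π c
    have hz : z ≠ 0 := mt map_eq_zero.2 hc0
    obtain ⟨z', hz', h₃⟩ := Coordinates.exists_sub (π := π') (π z) u' (π (u - z)) (by
      rw [hu']
      exact (col_sub π u z).swap)
    have hzv := noncol hu hz' hv' hcu.symm huv (fun h' => hc h'.swap_right) h₃ h₁
    have hzw := noncol hu hz' hw' hcu.symm huw (fun h' => by
      rcases Col.line h.swap_right h'.swap_right with h'' | h''
      · exact hcv h''.symm
      · exact hc h''.rot) h₃ h₂
    refine noncol hz hv' hw' hcv (fun h' => hc (h' ▸ h)) (fun h' => ?_) hzv hzw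
    rcases Col.line h.rot' h'.rot' with h'' | h''
    · exact hcu h''.symm
    · exact hc h''.swap_right
  · exact noncol hu hv' hw' huv huw h h₁ h₂

instance : HomogeneousChart π where
  exists_scalar v w hv h := by
    obtain ⟨φ, hφ, hφπ⟩ := exists_addMonoidHom π π hv h.symm
    exact ⟨⟨φ, fun x => Or.inr (hφπ x)⟩, hφ⟩

variable {π}

theorem exists_scalar_ne_zero_ne_one : ∃ k : scalars π, k ≠ 0 ∧ k ≠ 1 := by
  obtain ⟨v, hv, -⟩ := exists_ne π 0
  obtain ⟨w, hw, hwv⟩ := exists_ne π v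
  obtain ⟨c, d, hc, hd, hcd⟩ := exists_two_col (map_ne_zero hv) (map_ne_zero hw) hwv.symm
  obtain ⟨x, hx, hx'⟩ := Coordinates.exists_sub (π := π) (π v) w c hc
  obtain ⟨y, hy, hy'⟩ := Coordinates.exists_sub (π := π) (π v) w d hd
  have hx0 : x ≠ 0 := fun h => by
    rw [h, map_zero π, eq_comm] at hx
    exact map_ne_zero hv hx
  have hy0 : y ≠ 0 := fun h => by
    rw [h, map_zero π, eq_comm] at hy
    exact map_ne_zero hv hy
  obtain ⟨k, hk⟩ := HomogeneousChart.exists_scalar (π := π) x y hx0 (hx.trans hy.symm)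
  refine ⟨k, fun h => hy0 ?_, fun h => hcd ?_⟩
  · rw [← hk, h, zero_smul]
  · rw [← hx', ← hy', ← hk, h, one_smul]

/-- A vector whose class lies in the sum of two classes is a linear combination. -/
theorem exists_smul_add_smul {x y z : V} (h : Col (π x) (π y) (π z)) :
    ∃ a b : scalars π, z = a • x + b • y := by
  obtain ⟨u, hu, hu'⟩ := Coordinates.exists_sub (π := π) _ y _ h
  obtain ⟨a, rfl⟩ : ∃ a : scalars π, a • x = u := by
    by_cases hx : x = 0
    · rw [hx, map_zero π, map_eq_zero] at hu
      exact ⟨0, by rw [hu, zero_smul]⟩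
    · exact HomogeneousChart.exists_scalar (π := π) _ _ hx hu.symm
  by_cases hz : z = 0
  · exact ⟨0, 0, by simp [hz]⟩
  · obtain ⟨b, hb⟩ := HomogeneousChart.exists_scalar (π := π) (y - a • x) z (fun h => hz (by
      rwa [h, map_zero π, eq_comm, map_eq_zero] at hu')) hu'
    refine ⟨-(b * a), b, ?_⟩
    rw [← hb, smul_sub, neg_smul, mul_smul]
    abel

end Coordinates

/-! ### Lines, commutative hyperfields, and a rigidity property of division rings -/

section OnLine

variable {H : Type*} [Hyperring H] {a b p q x y : H}

/-- The line through `a` and `b` with `0` adjoined. -/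
def OnLine (a b x : H) : Prop := x = 0 ∨ x = a ∨ x = b ∨ Col a b x

theorem OnLine.swap (h : OnLine a b x) : OnLine b a x := by
  rcases h with h | h | h | h
  exacts [Or.inl h, Or.inr (Or.inr (Or.inl h)), Or.inr (Or.inl h), Or.inr (Or.inr (Or.inr h.swap))]

theorem OnLine.mul_left (g : H) (h : OnLine a b x) : OnLine (g * a) (g * b) (g * x) := by
  rcases h with rfl | rfl | rfl | h
  · exact Or.inl (mul_zero g)
  · exact Or.inr (Or.inl rfl)
  · exact Or.inr (Or.inr (Or.inl rfl))
  · exact Or.inr (Or.inr (Or.inr (col_mul_left g h)))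

variable [Hyperring.IsIdempotent H]

theorem OnLine.left (h : OnLine a b p) (hp : p ≠ 0) (hpb : p ≠ b) (hx : OnLine a b x) :
    OnLine p b x := by
  rcases h with h | rfl | h | h
  · exact absurd h hp
  · exact hx
  · exact absurd h hpb
  · rcases hx with hx | rfl | hx | hx
    · exact Or.inl hx
    · exact Or.inr (Or.inr (Or.inr h.swap_outer))
    · exact Or.inr (Or.inr (Or.inl hx))
    · rcases Col.line h.swap hx.swap with h' | h'
      · exact Or.inr (Or.inl h'.symm)
      · exact Or.inr (Or.inr (Or.inr h'.swap_right))

/-- A line is spanned by any two of its points. -/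
theorem OnLine.exchange (hab : a ≠ b) (hp : OnLine a b p) (hq : OnLine a b q) (hp0 : p ≠ 0)
    (hq0 : q ≠ 0) (hpq : p ≠ q) (hx : OnLine a b x) : OnLine p q x := by
  by_cases hpb : p = b
  · subst hpb
    exact (hq.left hq0 hpq.symm hx).swap
  · exact ((hp.left hp0 hpb hq).swap.left hq0 hpq.symm (hp.left hp0 hpb hx).swap).swap

theorem OnLine.col (ha : a ≠ 0) (hb : b ≠ 0) (hab : a ≠ b) (hp : OnLine a b p)
    (hq : OnLine a b q) (h : Col p q x) : OnLine a b x := by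
  by_cases hp0 : p = 0
  · rw [hp0, col_zero_left] at h
    exact h ▸ hq
  by_cases hq0 : q = 0
  · rw [hq0, col_zero_mid] at h
    exact h ▸ hp
  by_cases hpq : p = q
  · rw [← hpq, col_self_iff] at h
    rcases h with h | h
    · exact Or.inl h
    · exact h ▸ hp
  · exact OnLine.exchange hpq (hp.exchange hab hq hp0 hq0 hpq (Or.inr (Or.inl rfl)))
      (hp.exchange hab hq hp0 hq0 hpq (Or.inr (Or.inr (Or.inl rfl)))) ha hb hab
      (Or.inr (Or.inr (Or.inr h)))

end OnLine

/-- A commutative hyperfield whose geometry is Desarguesian of dimension at least two. -/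
class Hyperring.IsDesarguesianHyperfield (H : Type*) [Hyperring H] : Prop
    extends Hyperring.IsDesarguesianSpace H where
  mul_swap : ∀ x y : H, x * y = y * x
  exists_mul_eq_one : ∀ x : H, x ≠ 0 → ∃ y, y * x = 1

namespace Hyperring.IsDesarguesianHyperfield

variable {H : Type*} [Hyperring H] [Hyperring.IsDesarguesianHyperfield H] {g x y c : H}

theorem mul_injective (hg : g ≠ 0) : Function.Injective fun x : H => g * x := by
  intro x y h
  obtain ⟨l, hl⟩ := exists_mul_eq_one g hg
  have := congrArg (fun z => l * z) h
  simpa only [← mul_assoc, hl, one_mul] using this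

theorem mul_eq_zero_iff (hg : g ≠ 0) : g * x = 0 ↔ x = 0 := by
  rw [← (mul_injective hg).eq_iff (a := x), mul_zero]

theorem exists_mul_eq (hg : g ≠ 0) (x : H) : ∃ y, g * y = x := by
  obtain ⟨l, hl⟩ := exists_mul_eq_one g hg
  exact ⟨l * x, by rw [← mul_assoc, mul_swap g, hl, one_mul]⟩

/-- If the line through `1` and `c` contains `c²`, then it is closed under division. -/
theorem onLine_of_mul (hc : c ≠ 0) (hc1 : c ≠ 1) (hcc : OnLine 1 c (c * c)) (hx : OnLine 1 c x)
    (hx0 : x ≠ 0) (h : OnLine 1 c (x * y)) : OnLine 1 c y := by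
  have h10 : (1 : H) ≠ 0 := Hyperring.zero_ne_one.symm
  have hxc : OnLine 1 c (x * c) := by
    rcases hx with hx | hx | hx | hx
    · exact absurd hx hx0
    · exact Or.inr (Or.inr (Or.inl (by rw [hx, one_mul])))
    · exact hx ▸ hcc
    · have := col_mul_left c hx
      rw [mul_one, mul_swap c x] at this
      exact OnLine.col h10 hc hc1.symm (Or.inr (Or.inr (Or.inl rfl))) hcc this
  have hne : x ≠ x * c := fun h => hc1 (mul_injective hx0 (by simpa using h.symm))
  have := OnLine.exchange hc1.symm hx hxc hx0 (mt (mul_eq_zero_iff hx0).1 hc) hne h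
  obtain ⟨l, hl⟩ := exists_mul_eq_one x hx0
  have := this.mul_left l
  rwa [← mul_assoc, ← mul_assoc, hl, one_mul, one_mul] at this

theorem coordinates_mul_left {V : Type*} [AddCommGroup V] (π : V → H) [Coordinates π]
    (hg : g ≠ 0) : Coordinates fun v => g * π v where
  map_eq_zero := (mul_eq_zero_iff hg).trans Coordinates.map_eq_zero
  col_add v w := col_mul_left g (Coordinates.col_add v w)
  exists_sub x v z h := by
    obtain ⟨x, rfl⟩ := exists_mul_eq hg x
    obtain ⟨z, rfl⟩ := exists_mul_eq hg z
    obtain ⟨l, hl⟩ := exists_mul_eq_one g hg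
    have := col_mul_left l h
    simp only [← mul_assoc, hl, one_mul] at this
    obtain ⟨u, hu, hu'⟩ := Coordinates.exists_sub (π := π) x v z this
    exact ⟨u, congrArg _ hu, congrArg _ hu'⟩

end Hyperring.IsDesarguesianHyperfield

/-- In characteristic two, expanding `t * t` in two ways gives a factored relation. -/
theorem add_sq_eq_zero_of_two_eq_zero {K : Type*} [Field K] (h2 : (2 : K) = 0) {c s t : K}
    (ht0 : t ≠ 0) (h : t = c * s + (1 - c * s) * s)
    (h' : t * t = c * (s * s) + (1 - c * (s * s)) * (s * s)) : (1 + c) * (c * (1 + s) ^ 2) = 0 := by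
  have hs : s ^ 2 ≠ 0 := by
    rw [pow_ne_zero_iff two_ne_zero]
    rintro rfl
    exact ht0 (by simpa using h)
  rw [← mul_right_inj' hs, mul_zero]
  linear_combination h' - (t + (c * s + (1 - c * s) * s)) * h + 2 * c * (1 + c) * s ^ 3 * h2

/-- A rigidity property of division rings with more than two elements. Polarization gives
`k y * σ x + k x * σ y = 0`, so that `k y = -(k 1 * σ y)`. If `k 1 ≠ 0`, then the ring is
commutative of characteristic two, and the multiplicativity of `σ` is contradicted. -/
theorem eq_zero_of_add_eq_mul {K : Type*} [DivisionRing K] (hK : ∃ t : K, t ≠ 0 ∧ t ≠ 1)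
    (σ : K →+* K) (k : K →+ K) (hk : 1 + k 1 ≠ 0) (h : ∀ x, x + k x = (1 + k x) * σ x) (x : K) :
    k x = 0 := by
  have polar : ∀ x y, k y * σ x + k x * σ y = 0 := by
    intro x y
    have h₁ := h (x + y)
    have hx := h x
    have hy := h y
    rw [map_add, map_add] at h₁
    have : (x + k x) + (y + k y) = (1 + (k x + k y)) * (σ x + σ y) := by rw [← h₁]; abel
    rw [hx, hy] at this
    have h₂ : (1 + (k x + k y)) * (σ x + σ y) =
      (1 + k x) * σ x + (1 + k y) * σ y + (k y * σ x + k x * σ y) := by noncomm_ring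
    rw [h₂] at this
    exact left_eq_add.1 this
  have hkσ : ∀ y, k y = -(k 1 * σ y) := fun y => by
    have := polar 1 y
    rwa [map_one, mul_one, ← eq_neg_iff_add_eq_zero] at this
  by_contra hx
  have hc : k 1 ≠ 0 := fun h => hx (by rw [hkσ, h, zero_mul, neg_zero])
  have anti : ∀ x y, σ y * σ x + σ x * σ y = 0 := by
    intro x y
    have := polar x y
    rw [hkσ x, hkσ y, neg_mul, neg_mul, ← neg_add, neg_eq_zero, mul_assoc, mul_assoc,
      ← mul_add] at this
    exact (mul_eq_zero.1 this).resolve_left hc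
  have h2 : (1 : K) + 1 = 0 := by simpa using anti 1 1
  have comm : ∀ x y : K, x * y = y * x := fun x y => σ.injective (by
    have := anti x y
    rw [map_mul, map_mul, eq_neg_of_add_eq_zero_right this]
    rw [neg_eq_iff_add_eq_zero, ← two_mul, ← one_add_one_eq_two, h2, zero_mul])
  obtain ⟨t, ht0, ht1⟩ := hK
  let _ : Field K := { ‹DivisionRing K› with mul_comm := comm }
  have eqn : ∀ t, t = k 1 * σ t + (1 - k 1 * σ t) * σ t := fun t => by
    have := h t
    rw [hkσ t, ← sub_eq_add_neg, ← sub_eq_add_neg, sub_eq_iff_eq_add'] at this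
    exact this
  have h₁ := eqn (t * t)
  rw [map_mul] at h₁
  have := add_sq_eq_zero_of_two_eq_zero (one_add_one_eq_two.symm.trans h2) ht0 (eqn t) h₁
  have hs : 1 + σ t ≠ 0 := fun h => ht1 (σ.injective (by
    rw [map_one]
    rw [← h2] at h
    exact add_left_cancel h))
  exact mul_ne_zero hk (mul_ne_zero hc (pow_ne_zero 2 hs)) this

/-! ### The product on the coordinate space -/

namespace Coordinates

open Chart HomogeneousChart Hyperring.IsDesarguesianHyperfield

variable {H V : Type*} [Hyperring H] [Hyperring.IsDesarguesianHyperfield H] [AddCommGroup V]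
  {π : V → H} [Coordinates π]

theorem unit_ne_zero {e : V} (he : π e = 1) : e ≠ 0 := by
  rintro rfl
  exact Hyperring.zero_ne_one (R := H) ((map_zero π).symm.trans he)

theorem exists_mulHom {e : V} (he : π e = 1) (v : V) :
    ∃ φ : V →+ V, φ e = v ∧ ∀ w, π (φ w) = π v * π w := by
  by_cases hv : v = 0
  · exact ⟨0, hv.symm, fun w => by
      rw [hv, map_zero π, zero_mul, AddMonoidHom.zero_apply, map_zero π]⟩
  · have := coordinates_mul_left π (map_ne_zero (π := π) hv)
    exact exists_addMonoidHom (fun w => π v * π w) π (unit_ne_zero he) (by rw [he, mul_one])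

/-- The additive map covering the multiplication by the class of `v` and taking the vector `e` of
class `1` to `v`. It is the multiplication by `v` for a product on `V` with unit `e`. -/
noncomputable def mulHom {e : V} (he : π e = 1) (v : V) : V →+ V := (exists_mulHom he v).choose

variable {e : V} (he : π e = 1)

@[simp]
theorem mulHom_unit (v : V) : mulHom he v e = v := (exists_mulHom he v).choose_spec.1

theorem map_mulHom (v w : V) : π (mulHom he v w) = π v * π w :=
  (exists_mulHom he v).choose_spec.2 w

/-- An additive map covering the multiplication by the class of `v`, up to zero, is determined by
its value at the unit. -/
theorem eq_mulHom {φ : V →+ V} {v : V} (h : ∀ w, π (φ w) = 0 ∨ π (φ w) = π v * π w)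
    (hv : φ e = v) : φ = mulHom he v := by
  by_cases hv0 : v = 0
  · refine AddMonoidHom.ext fun w => ?_
    rw [← sub_eq_zero, ← map_eq_zero (π := π)]
    have h₁ : π (φ w) = 0 := by
      have := h w
      rwa [hv0, map_zero π, zero_mul, or_self] at this
    have h₂ := map_mulHom he v w
    rw [hv0, map_zero π, zero_mul, map_eq_zero] at h₂
    rw [hv0, h₂, sub_zero, h₁]
  · exact addMonoidHom_ext (c := fun x => π v * x) (mul_injective (map_ne_zero hv0)) h
      (fun w => Or.inr (map_mulHom he v w)) (unit_ne_zero he) (hv.trans (mulHom_unit he v).symm)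

theorem mulHom_mulHom (v w x : V) : mulHom he v (mulHom he w x) = mulHom he (mulHom he v w) x := by
  refine DFunLike.congr_fun
    (eq_mulHom he (φ := (mulHom he v).comp (mulHom he w)) (fun x => ?_) ?_) x
  · right
    rw [AddMonoidHom.comp_apply, map_mulHom he, map_mulHom he, map_mulHom he, mul_assoc]
  · rw [AddMonoidHom.comp_apply, mulHom_unit]

theorem mulHom_smul_unit (k : scalars π) (x : V) : mulHom he (k • e) x = k • x := by
  refine (DFunLike.congr_fun (eq_mulHom he (φ := k.1) (fun x => ?_) rfl) x).symm
  change π (k • x) = 0 ∨ π (k • x) = π (k • e) * π x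
  by_cases hk : k = 0
  · left
    rw [hk, zero_smul, map_zero π]
  · right
    rw [map_smul hk, map_smul hk, he, one_mul]

theorem unit_mulHom (x : V) : mulHom he e x = x := by
  have := mulHom_smul_unit he 1 x
  rwa [one_smul, one_smul] at this

theorem exists_mulHom_eq {v : V} (hv : v ≠ 0) (w : V) : ∃ x, mulHom he v x = w := by
  obtain ⟨l, hl⟩ := exists_mul_eq_one (π v) (map_ne_zero hv)
  obtain ⟨x, rfl⟩ := surjective π l
  have hx : π (mulHom he v x) = π e := by rw [map_mulHom he, mul_swap, hl, he]
  obtain ⟨k, hk⟩ := exists_scalar (π := π) _ _ (unit_ne_zero he) hx.symm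
  have hk0 : k ≠ 0 := by
    rintro rfl
    rw [zero_smul] at hk
    rw [← hk, map_zero π, he] at hx
    exact Hyperring.zero_ne_one hx
  refine ⟨mulHom he x (k⁻¹ • w), ?_⟩
  rw [mulHom_mulHom, ← hk, mulHom_smul_unit, smul_inv_smul₀ hk0]

/-- The multiplication by `v` is semilinear over the division ring of scalars. -/
theorem exists_semilinear {v : V} (hv : v ≠ 0) :
    ∃ σ : scalars π →+* scalars π, ∀ k x, mulHom he v (k • x) = σ k • mulHom he v x := by
  have key : ∀ k : scalars π, ∃ l : scalars π, ∀ x,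
      mulHom he v (k • x) = l • mulHom he v x := by
    intro k
    by_cases hk : k = 0
    · exact ⟨0, fun x => by rw [hk, zero_smul, zero_smul, _root_.map_zero]⟩
    obtain ⟨l, hl⟩ := exists_scalar (π := π) v (mulHom he v (k • e)) hv (by
      rw [map_mulHom he, map_smul hk, he, mul_one])
    have hl0 : l ≠ 0 := by
      rintro rfl
      rw [zero_smul, eq_comm, ← map_eq_zero (π := π), map_mulHom he, map_smul hk, he, mul_one,
        map_eq_zero] at hl
      exact hv hl
    refine ⟨l, fun x => ?_⟩
    refine DFunLike.congr_fun (addMonoidHom_ext (π := π) (π' := π)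
      (φ := (mulHom he v).comp k.1) (ψ := l.1.comp (mulHom he v)) (c := fun x => π v * x)
      (mul_injective (map_ne_zero hv)) (fun x => Or.inr ?_) (fun x => Or.inr ?_)
      (unit_ne_zero he) ?_) x
    · change π (mulHom he v (k • x)) = _
      rw [map_mulHom he, map_smul hk]
    · change π (l • mulHom he v x) = _
      rw [map_smul hl0, map_mulHom he]
    · change mulHom he v (k • e) = l • mulHom he v e
      rw [mulHom_unit, hl]
  choose σ hσ using key
  have inj : ∀ {k l : scalars π}, k • v = l • v → k = l := fun h => by
    rw [← sub_eq_zero]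
    exact smul_eq_zero_imp (by rw [sub_smul, h, sub_self]) hv
  have hσ' : ∀ k, mulHom he v (k • e) = σ k • v := fun k => by rw [hσ, mulHom_unit]
  refine ⟨⟨⟨⟨σ, inj ?_⟩, fun k l => inj ?_⟩, inj ?_, fun k l => inj ?_⟩, hσ⟩
  · rw [← hσ', one_smul, one_smul, mulHom_unit]
  · rw [← hσ', mul_smul, hσ, hσ', mul_smul]
  · change σ 0 • v = _
    rw [← hσ', zero_smul, zero_smul, _root_.map_zero]
  · change σ (k + l) • v = (σ k + σ l) • v
    rw [← hσ', add_smul, _root_.map_add, hσ', hσ', add_smul]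

end Coordinates

/-! ### Commutativity of the product -/

namespace Coordinates

open Chart HomogeneousChart Hyperring.IsDesarguesianHyperfield

variable {H V : Type*} [Hyperring H] [Hyperring.IsDesarguesianHyperfield H] [AddCommGroup V]
  {π : V → H} [Coordinates π] {e : V} (he : π e = 1)

theorem onLine_smul_add_smul (a b : scalars π) (x y : V) :
    OnLine (π x) (π y) (π (a • x + b • y)) := by
  by_cases ha : a = 0
  · rw [ha, zero_smul, zero_add]
    rcases map_smul_eq b y with h | h
    · exact Or.inl h
    · exact Or.inr (Or.inr (Or.inl h))
  by_cases hb : b = 0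
  · rw [hb, zero_smul, add_zero, map_smul ha]
    exact Or.inr (Or.inl rfl)
  · have := Coordinates.col_add (π := π) (a • x) (b • y)
    rw [map_smul ha, map_smul hb] at this
    exact Or.inr (Or.inr (Or.inr this))

/-- Vectors of different nonzero classes are linearly independent. -/
theorem eq_zero_of_smul_add_smul {a b : scalars π} {x y : V} (hx : x ≠ 0) (hy : y ≠ 0)
    (hxy : π x ≠ π y) (h : a • x + b • y = 0) : a = 0 ∧ b = 0 := by
  have hb : b = 0 := by
    by_contra hb
    have h' : π (a • x) = π (b • y) := by rw [eq_neg_of_add_eq_zero_left h, map_neg π]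
    rw [map_smul hb] at h'
    rcases map_smul_eq a x with h'' | h''
    · exact map_ne_zero (π := π) hy (h'.symm.trans h'')
    · exact hxy (h''.symm.trans h')
  rw [hb, zero_smul, add_zero] at h
  exact ⟨smul_eq_zero_imp h hx, hb⟩

/-- The deviation from `(1 + w) u = u + w u`, as an additive map in `u`. -/
noncomputable def deviation (w : V) : V →+ V :=
  mulHom he (e + w) - AddMonoidHom.id V - mulHom he w

theorem deviation_apply (w u : V) :
    deviation he w u = mulHom he (e + w) u - u - mulHom he w u := rfl

theorem deviation_eq_zero_iff (w u : V) :
    deviation he w u = 0 ↔ mulHom he (e + w) u = u + mulHom he w u := by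
  rw [deviation_apply, sub_sub, sub_eq_zero]

/-- If `1`, `w`, `u`, `w u` are independent, then comparing coefficients in
`(1 + w) (1 + u) = (1 + w) + (1 + w) u` gives `(1 + w) u = u + w u`. -/
theorem deviation_eq_zero_of_indep {w u : V}
    (h : ∀ a b c d : scalars π, a • e + b • w + c • u + d • mulHom he w u = 0 →
      a = 0 ∧ b = 0 ∧ c = 0 ∧ d = 0) : deviation he w u = 0 := by
  rw [deviation_eq_zero_iff]
  have key : ∀ x, ∃ a b : scalars π, mulHom he (e + w) x = a • x + b • mulHom he w x := by
    intro x
    refine exists_smul_add_smul (π := π) ?_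
    have := col_mul_left (π x) (Coordinates.col_add (π := π) e w)
    rwa [he, mul_one, mul_swap, mul_swap (π x), ← map_mulHom he, ← map_mulHom he] at this
  obtain ⟨a, b, h₁⟩ := key u
  obtain ⟨c, d, h₂⟩ := key (e + u)
  rw [_root_.map_add, _root_.map_add, mulHom_unit, mulHom_unit, h₁] at h₂
  have h₃ : (1 - c) • e + (1 - d) • w + (a - c) • u + (b - d) • mulHom he w u = 0 := by
    have h₄ := sub_eq_zero.2 h₂
    rw [← h₄]
    simp only [sub_smul, one_smul, smul_add]
    abel
  obtain ⟨hc, hd, ha, hb⟩ := h _ _ _ _ h₃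
  rw [h₁, sub_eq_zero.1 ha, sub_eq_zero.1 hb, ← sub_eq_zero.1 hc, ← sub_eq_zero.1 hd, one_smul,
    one_smul]

theorem deviation_smul_unit (k : scalars π) : deviation he (k • e) = 0 := by
  refine AddMonoidHom.ext fun u => ?_
  change deviation he (k • e) u = 0
  have : e + k • e = (1 + k) • e := by rw [add_smul, one_smul]
  rw [deviation_eq_zero_iff, this, mulHom_smul_unit, mulHom_smul_unit, add_smul, one_smul]

/-- The case in which the line through `1` and `w` is closed under multiplication. Vectors off this
line are covered by the independent case, and they generate all vectors. -/
theorem deviation_eq_zero_of_onLine {w : V} (hw : w ≠ 0) (hwe : π w ≠ 1)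
    (h : OnLine 1 (π w) (π w * π w)) : deviation he w = 0 := by
  have he0 := unit_ne_zero he
  have h10 : (1 : H) ≠ 0 := Hyperring.zero_ne_one.symm
  have hw0 : π w ≠ 0 := map_ne_zero hw
  -- a relation between `1`, `w`, `u`, `w u` would put `u` into the subfield spanned by `1` and `w`
  have off : ∀ u, ¬ OnLine 1 (π w) (π u) → deviation he w u = 0 := by
    intro u hu
    have hu0 : u ≠ 0 := fun h => hu (Or.inl (by rw [h, map_zero π]))
    have hu0' : π u ≠ 0 := map_ne_zero hu0
    have hne : π u ≠ π (mulHom he w u) := by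
      intro h'
      rw [map_mulHom he, mul_swap] at h'
      exact hwe (mul_injective hu0' (by simpa using h'.symm))
    have hwu0 : mulHom he w u ≠ 0 := by
      rw [Ne, ← map_eq_zero (π := π), map_mulHom he, mul_eq_zero_iff hw0]
      exact hu0'
    refine deviation_eq_zero_of_indep he fun a b c d habcd => ?_
    rw [add_assoc] at habcd
    have h₁ := onLine_smul_add_smul (π := π) a b e w
    have h₂ := onLine_smul_add_smul (π := π) c d u (mulHom he w u)
    rw [eq_neg_of_add_eq_zero_left habcd, map_neg π, he] at h₁
    by_cases hz : c • u + d • mulHom he w u = 0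
    · rw [hz, add_zero] at habcd
      obtain ⟨ha, hb⟩ := eq_zero_of_smul_add_smul he0 hw (he ▸ hwe.symm) habcd
      exact ⟨ha, hb, eq_zero_of_smul_add_smul hu0 hwu0 hne hz⟩
    · exfalso
      obtain ⟨y, hy⟩ := exists_mul_eq hu0' (π (c • u + d • mulHom he w u))
      rw [← hy, map_mulHom he, mul_swap (π w)] at h₂
      obtain ⟨l, hl⟩ := exists_mul_eq_one (π u) hu0'
      have h₃ := h₂.mul_left l
      rw [← mul_assoc, ← mul_assoc, hl, one_mul, one_mul] at h₃
      have hy0 : y ≠ 0 := by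
        rintro rfl
        rw [mul_zero, eq_comm, map_eq_zero] at hy
        exact hz hy
      rw [← hy, mul_swap] at h₁
      exact hu (onLine_of_mul hw0 hwe h h₃ hy0 h₁)
  refine AddMonoidHom.ext fun u => ?_
  change deviation he w u = 0
  by_cases hu : OnLine 1 (π w) (π u)
  · obtain ⟨c, hc0, hc1, hcw, hc⟩ := Hyperring.IsDesarguesianSpace.exists_indep 1 (π w)
    obtain ⟨z, rfl⟩ := surjective π c
    have hz : ¬ OnLine 1 (π w) (π z) := by
      rintro (h | h | h | h)
      exacts [hc0 h, hc1 h, hcw h, hc h]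
    have huz : ¬ OnLine 1 (π w) (π (u + z)) := fun h' =>
      hz (OnLine.col h10 hw0 hwe.symm hu h' (Coordinates.col_add u z).swap_right)
    have := off _ huz
    rwa [_root_.map_add, off z hz, add_zero] at this
  · exact off u hu

/-- The generic case, in which `1`, `w`, `w²` are independent. The maps `k ↦ w k w⁻¹` and
`k ↦ (1 + w) k (1 + w)⁻¹` on scalars turn out to be the identity by comparing the products
`(1 + w) (1 + k w)` and `(1 + k w) (1 + w)`, which differ by a scalar factor. -/
theorem deviation_eq_zero_of_not_onLine {w : V} (hw : w ≠ 0) (hwe : π w ≠ 1)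
    (h : ¬ OnLine 1 (π w) (π w * π w)) : deviation he w = 0 := by
  have he0 := unit_ne_zero he
  have hw0 : π w ≠ 0 := map_ne_zero hw
  have hew : e + w ≠ 0 := add_ne_zero (π := π) (he ▸ hwe.symm)
  obtain ⟨w₂, hw₂⟩ : ∃ w₂, mulHom he w w = w₂ := ⟨_, rfl⟩
  have indep : ∀ a b c : scalars π, a • e + b • w + c • w₂ = 0 → a = 0 ∧ b = 0 ∧ c = 0 := by
    intro a b c habc
    have hc : c = 0 := by
      by_contra hc
      have h₁ := onLine_smul_add_smul (π := π) a b e w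
      rw [eq_neg_of_add_eq_zero_left habc, map_neg π, map_smul hc, ← hw₂, map_mulHom he, he] at h₁
      exact h h₁
    rw [hc, zero_smul, add_zero] at habc
    obtain ⟨ha, hb⟩ := eq_zero_of_smul_add_smul he0 hw (he ▸ hwe.symm) habc
    exact ⟨ha, hb, hc⟩
  obtain ⟨σ, hσ⟩ := exists_semilinear he hw
  obtain ⟨τ, hτ⟩ := exists_semilinear he hew
  -- `(1 + k w) w` is a multiple of `w (1 + k w)`
  have comm : ∀ k : scalars π, ∃ δ : scalars π,
      mulHom he (e + k • w) w = δ • (w + σ k • w₂) := by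
    intro k
    have hne : mulHom he w (e + k • w) ≠ 0 := by
      rw [_root_.map_add, mulHom_unit, hσ, hw₂]
      intro h0
      have := (indep 0 1 (σ k) (by rw [zero_smul, zero_add, one_smul, h0])).2.1
      exact one_ne_zero this
    obtain ⟨δ, hδ⟩ := exists_scalar (π := π) (mulHom he w (e + k • w)) (mulHom he (e + k • w) w) hne
      (by rw [map_mulHom he, map_mulHom he, mul_swap])
    rw [_root_.map_add, mulHom_unit, hσ, hw₂] at hδ
    exact ⟨δ, hδ.symm⟩
  obtain ⟨δ, hδ⟩ := comm 1
  rw [one_smul, _root_.map_one, one_smul] at hδ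
  have hδ0 : δ ≠ 0 := by
    rintro rfl
    rw [zero_smul, ← map_eq_zero (π := π), map_mulHom he, mul_eq_zero_iff (map_ne_zero hew)] at hδ
    exact hw0 hδ
  have eqn : ∀ k, k + (τ k * δ - k) = (1 + (τ k * δ - k)) * σ k := by
    intro k
    obtain ⟨δ', hδ'⟩ := comm k
    have h₁ : mulHom he (e + w) (e + k • w) = e + (1 + τ k * δ) • w + (τ k * δ) • w₂ := by
      rw [_root_.map_add, mulHom_unit, hτ, hδ, smul_smul, smul_add, add_smul, one_smul]
      abel
    have h₂ : mulHom he (e + k • w) (e + w) = e + (k + δ') • w + (δ' * σ k) • w₂ := by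
      rw [_root_.map_add, mulHom_unit, hδ', smul_add, smul_smul, add_smul]
      abel
    have hne : mulHom he (e + w) (e + k • w) ≠ 0 := by
      rw [h₁]
      intro h0
      exact one_ne_zero (indep 1 _ _ (by rw [one_smul, h0])).1
    obtain ⟨κ, hκ⟩ := exists_scalar (π := π) _ (mulHom he (e + k • w) (e + w)) hne
      (by rw [map_mulHom he, map_mulHom he, mul_swap])
    rw [h₁, h₂] at hκ
    have h₃ := sub_eq_zero.2 hκ
    obtain ⟨h₄, h₅, h₆⟩ := indep (κ - 1) (κ * (1 + τ k * δ) - (k + δ')) (κ * (τ k * δ) - δ' * σ k)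
      (by
        rw [← h₃]
        simp only [sub_smul, mul_smul, smul_add, one_smul]
        abel)
    rw [sub_eq_zero.1 h₄, one_mul, sub_eq_zero] at h₅ h₆
    have : δ' = 1 + (τ k * δ - k) := by
      rw [← add_sub_assoc, h₅, add_sub_cancel_left]
    rw [← this, ← h₆]
    abel
  -- hence both endomorphisms of the scalars are the identity, and `(1 + w) w = w + w²`
  have hk := eq_zero_of_add_eq_mul exists_scalar_ne_zero_ne_one σ
    ((AddMonoidHom.mulRight δ).comp τ.toAddMonoidHom - AddMonoidHom.id _) (by
      change 1 + (τ 1 * δ - 1) ≠ 0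
      rwa [_root_.map_one, one_mul, add_sub_cancel]) eqn
  have hτδ : ∀ k, τ k * δ = k := fun k => sub_eq_zero.1 (hk k)
  have hσ1 : ∀ k, σ k = k := fun k => by
    have := eqn k
    rw [hτδ, sub_self, add_zero, add_zero, one_mul] at this
    exact this.symm
  have hδ1 : δ = 1 := by
    have := hτδ 1
    rwa [_root_.map_one, one_mul] at this
  have hτ1 : ∀ k, τ k = k := fun k => by
    have := hτδ k
    rwa [hδ1, mul_one] at this
  rw [hδ1, one_smul] at hδ
  have hBk : ∀ (k : scalars π) x, mulHom he w (k • x) = k • mulHom he w x := fun k x => by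
    rw [hσ, hσ1]
  have hNk : ∀ (k : scalars π) x, deviation he w (k • x) = k • deviation he w x := fun k x => by
    rw [deviation_apply, deviation_apply, hτ, hτ1, hBk, smul_sub, smul_sub]
  have hAB : ∀ x, mulHom he (e + w) (mulHom he w x) = mulHom he w (mulHom he (e + w) x) := by
    intro x
    rw [mulHom_mulHom, mulHom_mulHom, hδ, _root_.map_add, mulHom_unit, hw₂]
  have hNB : ∀ x, deviation he w (mulHom he w x) = mulHom he w (deviation he w x) := by
    intro x
    rw [deviation_apply, deviation_apply, hAB, _root_.map_sub, _root_.map_sub]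
  have hNe : deviation he w e = 0 := by rw [deviation_eq_zero_iff, mulHom_unit, mulHom_unit]
  have hNw : deviation he w w = 0 := by rw [deviation_eq_zero_iff, hδ, hw₂]
  refine AddMonoidHom.ext fun u => ?_
  change deviation he w u = 0
  by_contra hu
  refine hu (deviation_eq_zero_of_indep he fun a b c d habcd => ?_)
  -- a relation would make the deviation at `u` an eigenvector of the multiplication by `w`
  have h₁ := congrArg (deviation he w) habcd
  rw [_root_.map_add, _root_.map_add, _root_.map_add, hNk, hNk, hNk, hNk, hNe, hNw, hNB,
    smul_zero, smul_zero, zero_add, zero_add, _root_.map_zero] at h₁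
  have hne : π (deviation he w u) ≠ π (mulHom he w (deviation he w u)) := by
    intro h'
    rw [map_mulHom he, mul_swap] at h'
    exact hwe (mul_injective (map_ne_zero hu) (by simpa using h'.symm))
  have hBu : mulHom he w (deviation he w u) ≠ 0 := by
    rw [Ne, ← map_eq_zero (π := π), map_mulHom he, mul_eq_zero_iff hw0]
    exact map_ne_zero hu
  obtain ⟨hc, hd⟩ := eq_zero_of_smul_add_smul hu hBu hne h₁
  rw [hc, hd, zero_smul, zero_smul, add_zero, add_zero] at habcd
  obtain ⟨ha, hb⟩ := eq_zero_of_smul_add_smul he0 hw (he ▸ hwe.symm) habcd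
  exact ⟨ha, hb, hc, hd⟩

theorem unit_add_mulHom (w u : V) : mulHom he (e + w) u = u + mulHom he w u := by
  rw [← deviation_eq_zero_iff]
  have key : deviation he w = 0 := by
    by_cases hw : w = 0
    · have := deviation_smul_unit he 0
      rwa [zero_smul, ← hw] at this
    by_cases hwe : π w = 1
    · obtain ⟨k, rfl⟩ := exists_scalar (π := π) e w (unit_ne_zero he) (he.trans hwe.symm)
      exact deviation_smul_unit he k
    by_cases h : OnLine 1 (π w) (π w * π w)
    · exact deviation_eq_zero_of_onLine he hw hwe h
    · exact deviation_eq_zero_of_not_onLine he hw hwe h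
  rw [key, AddMonoidHom.zero_apply]

theorem zero_mulHom (u : V) : mulHom he 0 u = 0 := by
  rw [← map_eq_zero (π := π), map_mulHom he, map_zero π, zero_mul]

theorem add_mulHom (v w u : V) : mulHom he (v + w) u = mulHom he v u + mulHom he w u := by
  by_cases hv : v = 0
  · rw [hv, zero_add, zero_mulHom, zero_add]
  obtain ⟨x, rfl⟩ := exists_mulHom_eq he hv w
  have : v + mulHom he v x = mulHom he v (e + x) := by rw [_root_.map_add, mulHom_unit]
  rw [this, ← mulHom_mulHom, unit_add_mulHom, _root_.map_add, mulHom_mulHom]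

/-- The product is commutative: the right multiplications, being additive, induce the same maps on
classes as the left multiplications. -/
theorem mulHom_comm (v w : V) : mulHom he v w = mulHom he w v := by
  let R : V →+ V := ⟨⟨fun v => mulHom he v w, zero_mulHom he w⟩, fun v v' => add_mulHom he v v' w⟩
  exact DFunLike.congr_fun (eq_mulHom he (φ := R) (fun x => Or.inr (by
    change π (mulHom he x w) = _
    rw [map_mulHom he, mul_swap])) (unit_mulHom he w)) v

end Coordinates

/-! ### The field and its uniqueness -/

namespace Coordinates

open Chart HomogeneousChart Hyperring.IsDesarguesianHyperfield

/-- The coordinate space with its product is a field. -/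
theorem exists_field (H : Type u) [Hyperring H] [Hyperring.IsDesarguesianHyperfield H] :
    ∃ (F : Type u) (_ : Field F) (π : F → H), Coordinates π ∧ ∀ x y, π (x * y) = π x * π y := by
  classical
  obtain ⟨M⟩ := Hyperplane.nonempty H
  obtain ⟨e, he⟩ := surjective M.point (1 : H)
  have he0 := unit_ne_zero he
  have hinv : ∀ v, ∃ w, v ≠ 0 → mulHom he v w = e := fun v => by
    by_cases hv : v = 0
    · exact ⟨0, fun h => absurd hv h⟩
    · obtain ⟨w, hw⟩ := exists_mulHom_eq he hv e
      exact ⟨w, fun _ => hw⟩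
  choose inv hinv using hinv
  let i : AddCommGroup (M.Translation × M.Scalars) := inferInstance
  let F : Field (M.Translation × M.Scalars) :=
    { i with
      mul := fun v w => mulHom he v w
      one := e
      mul_assoc := fun u v w => (mulHom_mulHom he u v w).symm
      one_mul := unit_mulHom he
      mul_one := mulHom_unit he
      left_distrib := fun u v w => _root_.map_add (mulHom he u) v w
      right_distrib := add_mulHom he
      zero_mul := zero_mulHom he
      mul_zero := fun u => _root_.map_zero (mulHom he u)
      mul_comm := mulHom_comm he
      inv := fun v => if v = 0 then 0 else inv v
      exists_pair_ne := ⟨e, 0, he0⟩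
      mul_inv_cancel := fun v hv => by
        change mulHom he v (if v = 0 then 0 else inv v) = e
        rw [if_neg hv, hinv v hv]
      inv_zero := if_pos rfl
      nnqsmul := _
      nnqsmul_def := fun _ _ => rfl
      qsmul := _
      qsmul_def := fun _ _ => rfl }
  exact ⟨_, F, M.point, inferInstanceAs (Coordinates M.point), map_mulHom he⟩

variable {H : Type*} [Hyperring H] [Hyperring.IsDesarguesianHyperfield H]
  {F F' : Type*} [Field F] [Field F'] {π : F → H} [Coordinates π] {π' : F' → H} [Coordinates π']

theorem map_one_of_mul (hπ : ∀ x y, π (x * y) = π x * π y) : π 1 = 1 := by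
  have h1 : π 1 ≠ 0 := mt map_eq_zero.1 one_ne_zero
  refine mul_injective h1 ?_
  change π 1 * π 1 = π 1 * 1
  rw [← hπ, mul_one, mul_one]

/-- Two fields with multiplicative coordinatizations of the same hyperfield are isomorphic in a
unique way. -/
theorem existsUnique_ringEquiv (hπ : ∀ x y, π (x * y) = π x * π y)
    (hπ' : ∀ x y, π' (x * y) = π' x * π' y) : ∃! σ : F ≃+* F', ∀ x, π' (σ x) = π x := by
  have h1 := map_one_of_mul hπ
  have h1' := map_one_of_mul hπ'
  obtain ⟨φ, hφ1, hφ⟩ := exists_addMonoidHom π π' one_ne_zero (h1'.trans h1.symm)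
  obtain ⟨ψ, hψ1, hψ⟩ := exists_addMonoidHom π' π one_ne_zero (h1.trans h1'.symm)
  have hψφ : ψ.comp φ = AddMonoidHom.id F :=
    addMonoidHom_ext (π := π) (π' := π) (c := fun x => x) Function.injective_id
      (fun x => Or.inr ((hψ _).trans (hφ x))) (fun x => Or.inr rfl) one_ne_zero
      (by rw [AddMonoidHom.comp_apply, hφ1, hψ1, AddMonoidHom.id_apply])
  have hφψ : φ.comp ψ = AddMonoidHom.id F' :=
    addMonoidHom_ext (π := π') (π' := π') (c := fun x => x) Function.injective_id
      (fun x => Or.inr ((hφ _).trans (hψ x))) (fun x => Or.inr rfl) one_ne_zero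
      (by rw [AddMonoidHom.comp_apply, hψ1, hφ1, AddMonoidHom.id_apply])
  have hmul : ∀ x y, φ (x * y) = φ x * φ y := by
    intro x y
    by_cases hx : x = 0
    · rw [hx, zero_mul, _root_.map_zero, zero_mul]
    refine DFunLike.congr_fun (addMonoidHom_ext (π := π) (π' := π')
      (φ := φ.comp (AddMonoidHom.mulLeft x)) (ψ := (AddMonoidHom.mulLeft (φ x)).comp φ)
      (mul_injective (map_ne_zero (π := π) hx)) (fun z => Or.inr ?_) (fun z => Or.inr ?_)
      one_ne_zero ?_) y
    · change π' (φ (x * z)) = π x * π z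
      rw [hφ, hπ]
    · change π' (φ x * φ z) = π x * π z
      rw [hπ', hφ, hφ]
    · change φ (x * 1) = φ x * φ 1
      rw [mul_one, hφ1, mul_one]
  refine ⟨⟨⟨φ, ψ, DFunLike.congr_fun hψφ, DFunLike.congr_fun hφψ⟩, hmul, _root_.map_add φ⟩, hφ,
    fun τ hτ => RingEquiv.ext fun x => ?_⟩
  exact DFunLike.congr_fun (addMonoidHom_ext (π := π) (π' := π') (c := fun x => x)
    Function.injective_id (φ := (τ : F →+* F').toAddMonoidHom) (ψ := φ)
    (fun x => Or.inr (hτ x)) (fun x => Or.inr (hφ x)) one_ne_zero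
    (by rw [hφ1]; exact _root_.map_one τ)) x

end Coordinates

theorem Subfield.mem_unitsSubgroup {F : Type*} [Field F] {K : Subfield F} {g : Fˣ} :
    g ∈ K.unitsSubgroup ↔ (g : F) ∈ K := by
  constructor
  · rintro ⟨k, rfl⟩
    exact k.1.2
  · intro h
    have h0 : (⟨g, h⟩ : K) ≠ 0 := fun h' => g.ne_zero (congrArg Subtype.val h')
    exact ⟨Units.mk0 ⟨g, h⟩ h0, Units.ext rfl⟩

namespace QuotientHyperring

variable {F : Type*} [Field F] {K : Subfield F}

theorem mk_unitsSubgroup_eq {x y : F} :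
    mk K.unitsSubgroup x = mk K.unitsSubgroup y ↔ ∃ k ∈ K, k ≠ 0 ∧ k * y = x := by
  rw [mk_eq_mk]
  constructor
  · rintro ⟨g, hg, h⟩
    exact ⟨g, Subfield.mem_unitsSubgroup.1 hg, g.ne_zero, h⟩
  · rintro ⟨k, hk, hk0, h⟩
    exact ⟨Units.mk0 k hk0, Subfield.mem_unitsSubgroup.2 hk, h⟩

theorem mk_mul (x y : F) :
    mk K.unitsSubgroup (x * y) = mk K.unitsSubgroup x * mk K.unitsSubgroup y := rfl

variable {H : Type*} [Hyperring H]

section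

variable (φ : HyperringIso (QuotientHyperring F K.unitsSubgroup) H)

/-- A field with quotient `H` coordinatizes `H`. -/
theorem coordinates_mk : Coordinates fun x => φ.toMulEquiv (mk K.unitsSubgroup x) where
  map_eq_zero {x} := by
    rw [← mk_eq_zero (G := K.unitsSubgroup)]
    exact (map_eq_zero_iff φ.toMulEquiv φ.toMulEquiv.injective)
  col_add x y := by
    have : φ.toMulEquiv (mk K.unitsSubgroup (x + y)) ∈ φ.toFun ''
        hadd (mk K.unitsSubgroup x) (mk K.unitsSubgroup y) := ⟨_, ⟨x, y, rfl, rfl, rfl⟩, rfl⟩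
    rwa [φ.map_hadd] at this
  exists_sub x v z h := by
    obtain ⟨a, rfl⟩ := φ.toMulEquiv.surjective x
    have h' : z ∈ hadd (φ.toFun a) (φ.toFun (mk K.unitsSubgroup v)) := h
    rw [← φ.map_hadd] at h'
    obtain ⟨_, ⟨a, v', rfl, hv, rfl⟩, rfl⟩ := h'
    obtain ⟨k, hk, hk0, rfl⟩ := mk_unitsSubgroup_eq.1 hv.symm
    refine ⟨-k * a, congrArg φ.toFun ?_, congrArg φ.toFun ?_⟩
    · exact mk_unitsSubgroup_eq.2 ⟨-k, neg_mem hk, neg_ne_zero.2 hk0, rfl⟩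
    · exact mk_unitsSubgroup_eq.2 ⟨k, hk, hk0, by ring⟩

theorem map_mk_mul (x y : F) : φ.toMulEquiv (mk K.unitsSubgroup (x * y)) =
    φ.toMulEquiv (mk K.unitsSubgroup x) * φ.toMulEquiv (mk K.unitsSubgroup y) := by
  rw [mk_mul, map_mul]

theorem mem_iff_map_mk (x : F) : x ∈ K ↔
    φ.toMulEquiv (mk K.unitsSubgroup x) = 0 ∨ φ.toMulEquiv (mk K.unitsSubgroup x) = 1 := by
  have h0 : φ.toMulEquiv (mk K.unitsSubgroup x) = 0 ↔ x = 0 :=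
    (coordinates_mk φ).map_eq_zero
  have h1 : φ.toMulEquiv (mk K.unitsSubgroup x) = 1 ↔ ∃ k ∈ K, k ≠ 0 ∧ k * 1 = x := by
    rw [← mk_unitsSubgroup_eq]
    exact map_eq_one_iff φ.toMulEquiv φ.toMulEquiv.injective
  rw [h0, h1]
  constructor
  · intro hx
    by_cases hx0 : x = 0
    · exact Or.inl hx0
    · exact Or.inr ⟨x, hx, hx0, mul_one x⟩
  · rintro (rfl | ⟨k, hk, -, rfl⟩)
    · exact K.zero_mem
    · rwa [mul_one]

end

variable [Hyperring.IsDesarguesianHyperfield H]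

/-- A field with a multiplicative coordinatization of a hyperfield has it as a quotient. -/
theorem exists_iso {π : F → H} [Coordinates π] (hπ : ∀ x y, π (x * y) = π x * π y) :
    ∃ (K : Subfield F) (φ : HyperringIso (QuotientHyperring F K.unitsSubgroup) H),
      ∀ x, φ.toMulEquiv (mk K.unitsSubgroup x) = π x := by
  have h1 := Coordinates.map_one_of_mul hπ
  have h0 : π 0 = 0 := Chart.map_zero π
  let K : Subfield F :=
    { carrier := {x | π x = 0 ∨ π x = 1}
      mul_mem' := by
        rintro a b (ha | ha) (hb | hb) <;> simp [hπ, ha, hb]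
      one_mem' := Or.inr h1
      add_mem' := fun ha hb => Chart.eq_zero_or_of_eq ha hb
      zero_mem' := Or.inl h0
      neg_mem' := fun {a} ha => by
        change π (-a) = 0 ∨ π (-a) = 1
        rwa [Chart.map_neg π]
      inv_mem' := fun a ha => by
        by_cases ha0 : a = 0
        · rw [ha0, inv_zero]
          exact Or.inl h0
        · have h := hπ a⁻¹ a
          rw [inv_mul_cancel₀ ha0, h1, ha.resolve_left (Chart.map_ne_zero ha0), mul_one] at h
          exact Or.inr h.symm }
  have hK : ∀ {k}, k ∈ K → k ≠ 0 → π k = 1 := fun hk hk0 =>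
    hk.resolve_left (Chart.map_ne_zero hk0)
  have hmk : ∀ {x y}, mk K.unitsSubgroup x = mk K.unitsSubgroup y ↔ π x = π y := by
    intro x y
    rw [mk_unitsSubgroup_eq]
    constructor
    · rintro ⟨k, hk, hk0, rfl⟩
      rw [hπ, hK hk hk0, one_mul]
    · intro h
      by_cases hy : y = 0
      · rw [hy, h0, Chart.map_eq_zero] at h
        exact ⟨1, K.one_mem, one_ne_zero, by rw [hy, h, mul_zero]⟩
      · have hx : x ≠ 0 := fun hx => by
          rw [hx, h0, eq_comm, Chart.map_eq_zero] at h
          exact hy h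
        refine ⟨x / y, Or.inr ?_, div_ne_zero hx hy, div_mul_cancel₀ x hy⟩
        have h' := hπ (x / y) y
        rw [div_mul_cancel₀ x hy, ← h, Hyperring.IsDesarguesianHyperfield.mul_swap] at h'
        refine (Hyperring.IsDesarguesianHyperfield.mul_injective (Chart.map_ne_zero (π := π) hx) ?_)
        change π x * π (x / y) = π x * 1
        rw [← h', mul_one]
  let f : QuotientHyperring F K.unitsSubgroup → H :=
    Quotient.lift π fun x y h => hmk.1 (Quotient.sound h)
  have hf : Function.Bijective f := by
    constructor
    · intro a b h
      obtain ⟨x, rfl⟩ := mk_surjective a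
      obtain ⟨y, rfl⟩ := mk_surjective b
      exact hmk.2 h
    · intro z
      obtain ⟨x, rfl⟩ := Coordinates.surjective π z
      exact ⟨mk _ x, rfl⟩
  refine ⟨K, ⟨⟨Equiv.ofBijective f hf, fun a b => ?_⟩, fun a b => ?_⟩, fun x => rfl⟩
  · obtain ⟨x, rfl⟩ := mk_surjective a
    obtain ⟨y, rfl⟩ := mk_surjective b
    exact hπ x y
  · obtain ⟨x, rfl⟩ := mk_surjective a
    obtain ⟨y, rfl⟩ := mk_surjective b
    ext z
    constructor
    · rintro ⟨_, ⟨x', y', hx, hy, rfl⟩, rfl⟩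
      change π (x' + y') ∈ hadd (π x) (π y)
      rw [← hmk.1 hx, ← hmk.1 hy]
      exact Coordinates.col_add x' y'
    · intro h
      obtain ⟨u, hu, hu'⟩ := Coordinates.exists_sub (π := π) (π x) y z h
      refine ⟨mk _ (-u + y), ⟨-u, y, hmk.2 ?_, rfl, rfl⟩, ?_⟩
      · rw [Chart.map_neg π, hu]
      · rw [neg_add_eq_sub]
        exact hu'

end QuotientHyperring

namespace Hyperring

variable {H : Type*} [Hyperring H]

theorem IsKrasnerExtension.isIdempotent (h : IsKrasnerExtension H) : IsIdempotent H := by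
  obtain ⟨i, -, hi⟩ := h
  have h11 : hadd (1 : H) 1 = {0, 1} := by
    have := hi 1 1
    rw [map_one] at this
    rw [← this, show hadd (1 : Krasner) 1 = {0, 1} from rfl, Set.image_pair, map_zero, map_one]
  refine ⟨fun x => ?_⟩
  have := mul_hadd x 1 1
  rw [mul_one, h11, Set.image_pair, mul_zero, mul_one] at this
  exact this.symm

theorem col_of_coll [IsIdempotent H] {a b c : {x : H // x ≠ 0}}
    (h : (geometry H).Coll a b c) (hab : a ≠ b) (hac : a ≠ c) (hbc : b ≠ c) :
    Col (a : H) b c := by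
  obtain ⟨_, ⟨x, y, hxy, rfl⟩, ha, hb, hc⟩ := h
  have key : ∀ {z : {x : H // x ≠ 0}}, z ∈ {z : {x : H // x ≠ 0} | (z : H) ∈ hadd (x : H) (y : H)} ∪
      ({x, y} : Set {x : H // x ≠ 0}) → OnLine (x : H) y z := by
    rintro z (hz | rfl | rfl)
    · exact Or.inr (Or.inr (Or.inr hz))
    · exact Or.inr (Or.inl rfl)
    · exact Or.inr (Or.inr (Or.inl rfl))
  rcases OnLine.exchange (fun h => hxy (Subtype.ext h)) (key ha) (key hb) a.2 b.2
    (fun h => hab (Subtype.ext h)) (key hc) with h | h | h | h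
  · exact absurd h c.2
  · exact absurd (Subtype.ext h.symm) hac
  · exact absurd (Subtype.ext h.symm) hbc
  · exact h

theorem coll_of_col {a b c : {x : H // x ≠ 0}} (hab : a ≠ b) (h : Col (a : H) b c) :
    (geometry H).Coll a b c :=
  ⟨_, ⟨a, b, hab, rfl⟩, Or.inr (Or.inl rfl), Or.inr (Or.inr rfl), Or.inl h⟩

/-- In dimension at least two no two points span the geometry. -/
theorem exists_indep_of_dim [IsIdempotent H] (hdim : 2 ≤ (geometry H).dim) (a b : H) :
    ∃ c, c ≠ 0 ∧ c ≠ a ∧ c ≠ b ∧ ¬ Col a b c := by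
  by_contra! hcon
  let S : Set {x : H // x ≠ 0} := Subtype.val ⁻¹' {a, b}
  have hS : S.encard ≤ 2 := by
    refine le_trans ?_ ((Set.encard_insert_le {b} a).trans_eq (by
      rw [Set.encard_singleton, one_add_one_eq_two]))
    rw [← Subtype.val_injective.encard_image S]
    exact Set.encard_le_encard (Set.image_preimage_subset _ _)
  have hspan : (geometry H).span S = Set.univ := by
    refine Set.eq_univ_of_forall fun c => Set.mem_sInter.2 fun W hW => ?_
    obtain ⟨hW, hSW⟩ := hW
    by_cases hca : (c : H) = a
    · exact hSW (Or.inl hca)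
    by_cases hcb : (c : H) = b
    · exact hSW (Or.inr hcb)
    have hcol := hcon c c.2 hca hcb
    have ha : a ≠ 0 := by
      rintro rfl
      exact hcb (col_zero_left.1 hcol)
    have hb : b ≠ 0 := by
      rintro rfl
      exact hca (col_zero_mid.1 hcol).symm
    have hab : a ≠ b := by
      rintro rfl
      exact (col_self_iff.1 hcol).elim c.2 hca
    exact hW ⟨a, ha⟩ (hSW (Or.inl rfl)) ⟨b, hb⟩ (hSW (Or.inr rfl))
      (fun h => hab (congrArg Subtype.val h)) _ ⟨_, _, fun h => hab (congrArg Subtype.val h), rfl⟩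
      (Or.inr (Or.inl rfl)) (Or.inr (Or.inr rfl)) (Or.inl hcol)
  have h : (geometry H).dim ≤ 2 - 1 :=
    tsub_le_tsub_right ((iInf₂_le S hspan).trans hS) 1
  have h21 : (2 : ℕ∞) ≤ 1 := hdim.trans h
  norm_num at h21

theorem isDesarguesianHyperfield (hcomm : ∀ x y : H, x * y = y * x) (hfield : IsHyperfield H)
    (hext : IsKrasnerExtension H) (hdes : (geometry H).IsDesarguesian)
    (hdim : 2 ≤ (geometry H).dim) : IsDesarguesianHyperfield H := by
  have := hext.isIdempotent
  refine
    { exists_indep := exists_indep_of_dim hdim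
      mul_swap := hcomm
      exists_mul_eq_one := fun x hx => (hfield x hx).imp fun y hy => hy.2
      desargues := ?_ }
  intro o a₁ a₂ a₃ b₁ b₂ b₃ c₁₂ c₂₃ c₁₃ ha₁₂ ha₂₃ ha₁₃ ha hb₁₂ hb₂₃ hb₁₃ hb h₁ h₂ h₃ ho₁ ho₂ ho₃
    hc₁₂ hc₁₂' hc₂₃ hc₂₃' hc₁₃ hc₁₃'
  by_cases h₁₂₃ : c₁₂ = c₂₃
  · exact Or.inl h₁₂₃
  by_cases h₁₂₁₃ : c₁₂ = c₁₃
  · exact Or.inr (Or.inl h₁₂₁₃)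
  by_cases h₂₃₁₃ : c₂₃ = c₁₃
  · exact Or.inr (Or.inr (Or.inl h₂₃₁₃))
  refine Or.inr (Or.inr (Or.inr ?_))
  have nc : ∀ {x y z : H} (h : Indep x y z),
      ¬ (geometry H).Coll ⟨x, h.1⟩ ⟨y, h.2.1⟩ ⟨z, h.2.2.1⟩ := by
    intro x y z h h'
    obtain ⟨hx, hy, hz, hxy, hxz, hyz, hcol⟩ := h
    exact hcol (col_of_coll h' (fun h => hxy (congrArg Subtype.val h))
      (fun h => hxz (congrArg Subtype.val h)) (fun h => hyz (congrArg Subtype.val h)))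
  have col : ∀ {x y z : H} (hx : x ≠ 0) (hy : y ≠ 0) (hz : z ≠ 0) (_ : x ≠ y) (_ : Col x y z),
      (geometry H).Coll ⟨x, hx⟩ ⟨y, hy⟩ ⟨z, hz⟩ := fun _ _ _ h h' =>
    coll_of_col (fun h'' => h (congrArg Subtype.val h'')) h'
  have ne : ∀ {x y : H} {hx : x ≠ 0} {hy : y ≠ 0}, x ≠ y → (⟨x, hx⟩ : {x : H // x ≠ 0}) ≠ ⟨y, hy⟩ :=
    fun h h' => h (congrArg Subtype.val h')
  obtain ⟨ho0, ha₁0, ha₂0, hoa₁, hoa₂, ha₁₂ne, -⟩ := id ha₁₂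
  obtain ⟨-, -, ha₃0, -, hoa₃, ha₂₃ne, -⟩ := id ha₂₃
  obtain ⟨-, hb₁0, hb₂0, -, -, hb₁₂ne, -⟩ := id hb₁₂
  obtain ⟨-, -, hb₃0, -, -, hb₂₃ne, -⟩ := id hb₂₃
  have ha₁₃ne : a₁ ≠ a₃ := ha.2.2.2.2.1
  have hb₁₃ne : b₁ ≠ b₃ := hb.2.2.2.2.1
  have h := hdes ⟨o, ho0⟩ ⟨a₁, ha₁0⟩ ⟨a₂, ha₂0⟩ ⟨a₃, ha₃0⟩ ⟨b₁, hb₁0⟩ ⟨b₂, hb₂0⟩ ⟨b₃, hb₃0⟩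
    ⟨c₁₂, hc₁₂.ne_zero ha₁₂ne⟩ ⟨c₂₃, hc₂₃.ne_zero ha₂₃ne⟩ ⟨c₁₃, hc₁₃.ne_zero ha₁₃ne⟩
    (nc ha₁₂) (nc ha₂₃) (nc ha₁₃) (nc ha) (nc hb₁₂) (nc hb₂₃) (nc hb₁₃) (nc hb)
    (ne h₁) (ne h₂) (ne h₃) (col _ _ _ hoa₁ ho₁) (col _ _ _ hoa₂ ho₂) (col _ _ _ hoa₃ ho₃)
    (col _ _ _ ha₁₂ne hc₁₂) (col _ _ _ hb₁₂ne hc₁₂') (col _ _ _ ha₂₃ne hc₂₃)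
    (col _ _ _ hb₂₃ne hc₂₃') (col _ _ _ ha₁₃ne hc₁₃) (col _ _ _ hb₁₃ne hc₁₃')
  exact col_of_coll h (ne h₁₂₃) (ne h₁₂₁₃) (ne h₂₃₁₃)

end Hyperring

theorem theorem3p6 (H : Type u) [Hyperring H]
    (hcomm : ∀ x y : H, x * y = y * x)
    (hfield : Hyperring.IsHyperfield H)
    (hext : Hyperring.IsKrasnerExtension H)
    (hdes : (Hyperring.geometry H).IsDesarguesian)
    (hdim : 2 ≤ (Hyperring.geometry H).dim) :
    ∃ (F : Type u) (_ : Field F) (K : Subfield F)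
      (φ : HyperringIso (QuotientHyperring F K.unitsSubgroup) H),
      ∀ (F' : Type v) [Field F'] (K' : Subfield F')
        (φ' : HyperringIso (QuotientHyperring F' K'.unitsSubgroup) H),
        ∃! σ : F ≃+* F', K.map (σ : F →+* F') = K' ∧
          ∀ x : F, φ'.toMulEquiv (QuotientHyperring.mk K'.unitsSubgroup (σ x)) =
            φ.toMulEquiv (QuotientHyperring.mk K.unitsSubgroup x) := by
  have := Hyperring.isDesarguesianHyperfield hcomm hfield hext hdes hdim
  obtain ⟨F, _, π, _, hπ⟩ := Coordinates.exists_field H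
  obtain ⟨K, φ, hφ⟩ := QuotientHyperring.exists_iso hπ
  refine ⟨F, inferInstance, K, φ, fun F' _ K' φ' => ?_⟩
  have := QuotientHyperring.coordinates_mk φ'
  obtain ⟨σ, hσ, hσu⟩ := Coordinates.existsUnique_ringEquiv
    (π' := fun x => φ'.toMulEquiv (QuotientHyperring.mk K'.unitsSubgroup x)) hπ
    (QuotientHyperring.map_mk_mul φ')
  refine ⟨σ, ⟨?_, fun x => (hσ x).trans (hφ x).symm⟩,
    fun τ hτ => hσu τ fun x => (hτ.2 x).trans (hφ x)⟩
  -- both subfields are the preimages of `{0, 1}` in `H`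
  have key : ∀ x, x ∈ K ↔ σ x ∈ K' := fun x => by
    rw [QuotientHyperring.mem_iff_map_mk φ, QuotientHyperring.mem_iff_map_mk φ', hφ, hσ]
  ext y
  rw [Subfield.mem_map]
  constructor
  · rintro ⟨x, hx, rfl⟩
    exact (key x).1 hx
  · intro hy
    obtain ⟨x, rfl⟩ := σ.surjective y
    exact ⟨x, (key x).2 hy, rfl⟩
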